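/- Let $\Phi$ be a commutative unital ring in which $2$ and $3$ are invertible, and let $A$ be an associative, not necessarily unital, non-commutative $\Phi$-algebra with a $\Phi$-linear involution $*$. A $*$-ideal of $A$ is a two-sided (algebra) ideal $I$ with $I^*=I$. The algebra $A$ is $*$-prime if the product of any two non-zero $*$-ideals is non-zero, and $*$-semiprime if the square of any non-zero $*$-ideal is non-zero; a proper $*$-ideal $I$ of $A$ is $*$-prime if $A/I$ (with the induced involution) is a $*$-prime algebra. For a semiprime algebra $B$, let $\mathcal C(B)$ be its extended centroid, that is, the center of the two-sided right (Martindale) ring of quotients $Q(B)\supseteq B$. For $x\in B$ let $\deg(x)\in\mathbb N\cup\{\infty\}$ be the degree of algebraicity of $x$ over $\mathcal C(B)$, i.e. the least degree of a monic polynomial over $\mathcal C(B)$ vanishing at $x$ in $Q(B)$ ($\infty$ if there is none), and put $\deg(B)=\sup_{x\in B}\deg(x)$. Let $Z(A)$ be the associative center of $A$, let $K=\{x\in A : x^*=-x\}$, a Lie algebra under $[x,y]=xy-yx$, and let $Z(K)=\{x\in K : [x,K]=0\}$ be its center. Let $\mathrm{SDer}(A)$ be the Lie algebra of all ($\Phi$-linear,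 associative) derivations $\delta$ of $A$ such that $\delta(x^*)=\delta(x)^*$ for all $x\in A$, and let $I_{K,Z}=\{\delta\in\mathrm{SDer}(A) : \delta(K)\subseteq Z(A)\}$, a Lie ideal of $\mathrm{SDer}(A)$. A Lie algebra $L$ is strongly non-degenerate if $x\in L$ and $[x,[x,L]]=0$ imply $x=0$. Assume that $A$ is $*$-semiprime and that $\deg(A/I)>2$ for every $*$-prime ideal $I$ of $A$. Then: (i) $\mathrm{SDer}(A)/I_{K,Z}$ is a strongly non-degenerate Lie algebra. (ii) If $Z(K)$ contains no non-zero $*$-ideal of $A$, then $\mathrm{SDer}(A)$ is a strongly non-degenerate Lie algebra. In particular, if $A$ is $*$-prime, then $Z(K)$ contains no non-zero $*$-ideal of $A$ and $\mathrm{SDer}(A)$ is strongly non-degenerate. -/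

import Mathlib

/-! ### Rings of quotients, the extended centroid and the degree -/

namespace Martindale

variable {B : Type*} [NonUnitalRing B]

/-- The left annihilator of `B` in itself is zero. Every semiprime ring has this property. -/
def IsFaithful (B : Type*) [NonUnitalRing B] : Prop :=
  ∀ x : B, (∀ y : B, x * y = 0) → x = 0

/-- A two-sided ideal `J` is dense if `x J = 0` forces `x = 0`. When `B` is semiprime these are
exactly the essential two-sided ideals. (The premise `IsFaithful B` holds for every semiprime `B`;
a ring without it has no ideal with zero left annihilator, and then every ideal counts as dense,
which makes the ring of quotients below trivial.) -/
def IsDense (J : TwoSidedIdeal B) : Prop :=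
  IsFaithful B → ∀ x : B, (∀ y ∈ J, x * y = 0) → x = 0

/-- `f` restricts to a homomorphism of right `B`-modules `J → B`. The values of `f` outside `J`
play no role. -/
def IsHomOn (J : TwoSidedIdeal B) (f : B → B) : Prop :=
  (∀ x ∈ J, ∀ y ∈ J, f (x + y) = f x + f y) ∧ ∀ x ∈ J, ∀ b : B, f (x * b) = f x * b

/-- The ideal of all finite sums of products `x y` with `x ∈ I`, `y ∈ J`. -/
def prodIdeal (I J : TwoSidedIdeal B) : TwoSidedIdeal B :=
  TwoSidedIdeal.mk' (AddSubgroup.closure {z : B | ∃ x ∈ I, ∃ y ∈ J, z = x * y} : Set B)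
    (zero_mem _) (fun hx hy => add_mem hx hy) (fun hx => neg_mem hx)
    (by
      intro a z hz
      refine AddSubgroup.closure_induction (p := fun z _ =>
        a * z ∈ AddSubgroup.closure {z : B | ∃ x ∈ I, ∃ y ∈ J, z = x * y}) ?_ ?_ ?_ ?_ hz
      · rintro _ ⟨x, hx, y, hy, rfl⟩
        exact AddSubgroup.subset_closure ⟨a * x, I.mul_mem_left _ _ hx, y, hy, (mul_assoc _ _ _).symm⟩
      · simp
      · intro x y _ _ hx hy
        rw [mul_add]; exact add_mem hx hy
      · intro x _ hx
        rw [mul_neg]; exact neg_mem hx)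
    (by
      intro z a hz
      refine AddSubgroup.closure_induction (p := fun z _ =>
        z * a ∈ AddSubgroup.closure {z : B | ∃ x ∈ I, ∃ y ∈ J, z = x * y}) ?_ ?_ ?_ ?_ hz
      · rintro _ ⟨x, hx, y, hy, rfl⟩
        exact AddSubgroup.subset_closure ⟨x, hx, y * a, J.mul_mem_right _ _ hy, mul_assoc _ _ _⟩
      · simp
      · intro x y _ _ hx hy
        rw [add_mul]; exact add_mem hx hy
      · intro x _ hx
        rw [neg_mul]; exact neg_mem hx)

theorem mem_prodIdeal {I J : TwoSidedIdeal B} {z : B} :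
    z ∈ prodIdeal I J ↔ z ∈ AddSubgroup.closure {z : B | ∃ x ∈ I, ∃ y ∈ J, z = x * y} := by
  unfold prodIdeal
  rw [TwoSidedIdeal.mem_mk']
  rfl

theorem mul_mem_prodIdeal {I J : TwoSidedIdeal B} {x y : B} (hx : x ∈ I) (hy : y ∈ J) :
    x * y ∈ prodIdeal I J :=
  mem_prodIdeal.2 (AddSubgroup.subset_closure ⟨x, hx, y, hy, rfl⟩)

theorem prodIdeal_dense {I J : TwoSidedIdeal B} (hI : IsDense I) (hJ : IsDense J) :
    IsDense (prodIdeal I J) := fun hB z hz =>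
  hI hB z fun x hx => hJ hB _ fun y hy => by rw [mul_assoc]; exact hz _ (mul_mem_prodIdeal hx hy)

theorem prodIdeal_le_left {I J : TwoSidedIdeal B} {z : B} (hz : z ∈ prodIdeal I J) : z ∈ I := by
  refine AddSubgroup.closure_induction (p := fun z _ => z ∈ I) ?_ ?_ ?_ ?_ (mem_prodIdeal.1 hz)
  · rintro _ ⟨x, hx, y, hy, rfl⟩; exact I.mul_mem_right _ _ hx
  · exact I.zero_mem
  · exact fun _ _ _ _ h h' => I.add_mem h h'
  · exact fun _ _ h => I.neg_mem h

theorem prodIdeal_le_right {I J : TwoSidedIdeal B} {z : B} (hz : z ∈ prodIdeal I J) : z ∈ J := by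
  refine AddSubgroup.closure_induction (p := fun z _ => z ∈ J) ?_ ?_ ?_ ?_ (mem_prodIdeal.1 hz)
  · rintro _ ⟨x, hx, y, hy, rfl⟩; exact J.mul_mem_left _ _ hy
  · exact J.zero_mem
  · exact fun _ _ _ _ h h' => J.add_mem h h'
  · exact fun _ _ h => J.neg_mem h

theorem IsHomOn.mono {I J : TwoSidedIdeal B} {f : B → B} (hf : IsHomOn J f)
    (h : ∀ x ∈ I, x ∈ J) : IsHomOn I f :=
  ⟨fun x hx y hy => hf.1 x (h x hx) y (h y hy), fun x hx b => hf.2 x (h x hx) b⟩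

theorem IsHomOn.map_zero {J : TwoSidedIdeal B} {f : B → B} (hf : IsHomOn J f) : f 0 = 0 := by
  simpa using hf.1 0 J.zero_mem 0 J.zero_mem

theorem IsHomOn.map_mem {I J : TwoSidedIdeal B} {f : B → B} (hf : IsHomOn I f) {z : B}
    (hz : z ∈ prodIdeal I J) : f z ∈ J := by
  have key : z ∈ I ∧ f z ∈ J := by
    refine AddSubgroup.closure_induction (p := fun z _ => z ∈ I ∧ f z ∈ J) ?_ ?_ ?_ ?_
      (mem_prodIdeal.1 hz)
    · rintro _ ⟨x, hx, y, hy, rfl⟩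
      exact ⟨I.mul_mem_right _ _ hx, by rw [hf.2 x hx]; exact J.mul_mem_left _ _ hy⟩
    · exact ⟨I.zero_mem, by rw [hf.map_zero]; exact J.zero_mem⟩
    · exact fun x y _ _ h h' => ⟨I.add_mem h.1 h'.1, by
        rw [hf.1 x h.1 y h'.1]; exact J.add_mem h.2 h'.2⟩
    · intro x _ h
      refine ⟨I.neg_mem h.1, ?_⟩
      have h0 : f x + f (-x) = 0 := by
        rw [← hf.1 x h.1 _ (I.neg_mem h.1), add_neg_cancel, hf.map_zero]
      rw [eq_neg_of_add_eq_zero_right h0]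
      exact J.neg_mem h.2
  exact key.2

/-- Partially defined right module homomorphisms `J → B` with `J` a dense two-sided ideal. -/
structure DenseMap (B : Type*) [NonUnitalRing B] where
  /-- The map; only its values on some dense ideal matter. -/
  toFun : B → B
  exists_hom : ∃ J : TwoSidedIdeal B, IsDense J ∧ IsHomOn J toFun

/-- Two such maps are identified if they agree on a dense two-sided ideal. -/
instance denseSetoid : Setoid (DenseMap B) where
  r f g := ∃ J : TwoSidedIdeal B, IsDense J ∧ ∀ x ∈ J, f.toFun x = g.toFun x
  iseqv :=
    { refl := fun f => ⟨f.exists_hom.choose, f.exists_hom.choose_spec.1, fun _ _ => rfl⟩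
      symm := fun ⟨J, hJ, h⟩ => ⟨J, hJ, fun x hx => (h x hx).symm⟩
      trans := fun ⟨I, hI, h⟩ ⟨J, hJ, h'⟩ => ⟨prodIdeal I J, prodIdeal_dense hI hJ, fun x hx =>
        (h x (prodIdeal_le_left hx)).trans (h' x (prodIdeal_le_right hx))⟩ }

/-- Pointwise addition, defined on the intersection of the domains. -/
def DenseMap.add (f g : DenseMap B) : DenseMap B :=
  ⟨fun x => f.toFun x + g.toFun x, by
    obtain ⟨I, hI, hf⟩ := f.exists_hom
    obtain ⟨J, hJ, hg⟩ := g.exists_hom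
    refine ⟨prodIdeal I J, prodIdeal_dense hI hJ, fun x hx y hy => ?_, fun x hx b => ?_⟩
    all_goals beta_reduce
    · rw [hf.1 x (prodIdeal_le_left hx) y (prodIdeal_le_left hy),
        hg.1 x (prodIdeal_le_right hx) y (prodIdeal_le_right hy)]
      abel
    · rw [hf.2 x (prodIdeal_le_left hx), hg.2 x (prodIdeal_le_right hx), add_mul]⟩

/-- Pointwise negation. -/
def DenseMap.neg (f : DenseMap B) : DenseMap B :=
  ⟨fun x => -f.toFun x, by
    obtain ⟨I, hI, hf⟩ := f.exists_hom
    refine ⟨I, hI, fun x hx y hy => ?_, fun x hx b => ?_⟩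
    all_goals beta_reduce
    · rw [hf.1 x hx y hy]; abel
    · rw [hf.2 x hx, neg_mul]⟩

/-- Composition `f ∘ g`; if `f` is defined on `I` and `g` on `J`, it is defined on `J I`. -/
def DenseMap.comp (f g : DenseMap B) : DenseMap B :=
  ⟨fun x => f.toFun (g.toFun x), by
    obtain ⟨I, hI, hf⟩ := f.exists_hom
    obtain ⟨J, hJ, hg⟩ := g.exists_hom
    refine ⟨prodIdeal J I, prodIdeal_dense hJ hI, fun x hx y hy => ?_, fun x hx b => ?_⟩
    all_goals beta_reduce
    · rw [hg.1 x (prodIdeal_le_left hx) y (prodIdeal_le_left hy),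
        hf.1 _ (hg.map_mem hx) _ (hg.map_mem hy)]
    · rw [hg.2 x (prodIdeal_le_left hx), hf.2 _ (hg.map_mem hx)]⟩

theorem top_dense : IsDense (⊤ : TwoSidedIdeal B) :=
  fun hB x hx => hB x fun y => hx y trivial

/-- Left multiplication by `a`, defined on the whole ring. -/
def DenseMap.mulLeft (a : B) : DenseMap B :=
  ⟨fun x => a * x, ⊤, top_dense, fun _ _ _ _ => mul_add _ _ _, fun _ _ _ => (mul_assoc _ _ _).symm⟩

/-- The zero map. -/
def DenseMap.zero : DenseMap B :=
  ⟨fun _ => 0, ⊤, top_dense, fun _ _ _ _ => (add_zero 0).symm, fun _ _ _ => (zero_mul _).symm⟩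

/-- The identity map. -/
def DenseMap.one : DenseMap B :=
  ⟨fun x => x, ⊤, top_dense, fun _ _ _ _ => rfl, fun _ _ _ => rfl⟩

variable (B) in
/-- The two-sided right ring of quotients (Martindale's right ring of quotients) of `B`: the direct
limit of `Hom(J_B, B_B)` over all dense two-sided ideals `J`, with composition as product. -/
def RightQuotients : Type _ := Quotient (denseSetoid (B := B))

namespace RightQuotients

theorem sound {f g : DenseMap B} (J : TwoSidedIdeal B) (hJ : IsDense J)
    (h : ∀ x ∈ J, f.toFun x = g.toFun x) :
    (Quotient.mk _ f : RightQuotients B) = Quotient.mk _ g :=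
  Quotient.sound ⟨J, hJ, h⟩

theorem sound_of_eq {f g : DenseMap B} (h : ∀ x, f.toFun x = g.toFun x) :
    (Quotient.mk _ f : RightQuotients B) = Quotient.mk _ g :=
  sound ⊤ top_dense fun x _ => h x

instance : Zero (RightQuotients B) := ⟨Quotient.mk _ DenseMap.zero⟩

instance : One (RightQuotients B) := ⟨Quotient.mk _ DenseMap.one⟩

instance : Add (RightQuotients B) :=
  ⟨Quotient.map₂ DenseMap.add (by
    rintro f f' ⟨I, hI, h⟩ g g' ⟨J, hJ, h'⟩
    refine ⟨prodIdeal I J, prodIdeal_dense hI hJ, fun x hx => ?_⟩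
    change f.toFun x + g.toFun x = f'.toFun x + g'.toFun x
    rw [h x (prodIdeal_le_left hx), h' x (prodIdeal_le_right hx)])⟩

instance : Neg (RightQuotients B) :=
  ⟨Quotient.map DenseMap.neg (by
    rintro f f' ⟨I, hI, h⟩
    exact ⟨I, hI, fun x hx => congrArg Neg.neg (h x hx)⟩)⟩

instance : Mul (RightQuotients B) :=
  ⟨Quotient.map₂ DenseMap.comp (by
    rintro f f' ⟨I, hI, h⟩ g g' ⟨J, hJ, h'⟩
    obtain ⟨J₁, hJ₁, hg⟩ := g.exists_hom
    refine ⟨prodIdeal (prodIdeal J₁ J) I, prodIdeal_dense (prodIdeal_dense hJ₁ hJ) hI,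
      fun x hx => ?_⟩
    change f.toFun (g.toFun x) = f'.toFun (g'.toFun x)
    have hx' := prodIdeal_le_left hx
    rw [← h' x (prodIdeal_le_right hx')]
    exact h _ ((hg.mono fun _ hy => prodIdeal_le_left hy).map_mem hx))⟩

instance : Ring (RightQuotients B) where
  add_assoc := by
    rintro ⟨f⟩ ⟨g⟩ ⟨h⟩; exact sound_of_eq fun x => add_assoc _ _ _
  zero_add := by
    rintro ⟨f⟩; exact sound_of_eq fun x => zero_add _
  add_zero := by
    rintro ⟨f⟩; exact sound_of_eq fun x => add_zero _
  add_comm := by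
    rintro ⟨f⟩ ⟨g⟩; exact sound_of_eq fun x => add_comm _ _
  neg_add_cancel := by
    rintro ⟨f⟩; exact sound_of_eq fun x => neg_add_cancel _
  mul_assoc := by
    rintro ⟨f⟩ ⟨g⟩ ⟨h⟩; exact sound_of_eq fun x => rfl
  one_mul := by
    rintro ⟨f⟩; exact sound_of_eq fun x => rfl
  mul_one := by
    rintro ⟨f⟩; exact sound_of_eq fun x => rfl
  zero_mul := by
    rintro ⟨f⟩; exact sound_of_eq fun x => rfl
  mul_zero := by
    rintro ⟨f⟩
    obtain ⟨I, hI, hf⟩ := f.exists_hom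
    exact sound_of_eq fun x => hf.map_zero
  left_distrib := by
    rintro ⟨f⟩ ⟨g⟩ ⟨h⟩
    obtain ⟨I, hI, hf⟩ := f.exists_hom
    obtain ⟨J, hJ, hg⟩ := g.exists_hom
    obtain ⟨L, hL, hh⟩ := h.exists_hom
    refine sound (prodIdeal (prodIdeal J L) I) (prodIdeal_dense (prodIdeal_dense hJ hL) hI)
      fun x hx => ?_
    exact hf.1 _ ((hg.mono fun _ hy => prodIdeal_le_left hy).map_mem hx)
      _ ((hh.mono fun _ hy => prodIdeal_le_right hy).map_mem hx)
  right_distrib := by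
    rintro ⟨f⟩ ⟨g⟩ ⟨h⟩; exact sound_of_eq fun x => rfl
  nsmul := nsmulRec
  zsmul := zsmulRec

/-- The canonical map `B → RightQuotients B`, `a ↦ (x ↦ a x)`. -/
def ofBase : B →ₙ+* RightQuotients B where
  toFun a := Quotient.mk _ (DenseMap.mulLeft a)
  map_mul' _ _ := sound_of_eq fun _ => mul_assoc _ _ _
  map_zero' := sound_of_eq fun _ => zero_mul _
  map_add' _ _ := sound_of_eq fun _ => add_mul _ _ _

end RightQuotients

variable (B) in
/-- The extended centroid: the center of the two-sided right ring of quotients. -/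
abbrev ExtendedCentroid : Type _ := Subring.center (RightQuotients B)

/-- The degree of algebraicity of `x` over the extended centroid: the least degree of a monic
polynomial over the extended centroid that vanishes at `x`, and `⊤` if there is none. -/
noncomputable def elementDegree (x : B) : ℕ∞ :=
  ⨅ p : {p : Polynomial (ExtendedCentroid B) //
    p.Monic ∧ Polynomial.aeval (RightQuotients.ofBase x) p = 0}, (p.1.natDegree : ℕ∞)

variable (B) in
/-- `deg(B) = sup {deg(x) | x ∈ B}`. -/
noncomputable def degree : ℕ∞ := ⨆ x : B, elementDegree x

end Martindale

/-! ### Algebras with involution, `*`-ideals, `*`-prime and `*`-semiprime algebras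

An algebra over `Φ` need not be unital. The involution is `Φ`-linear: it is a `StarModule`
structure over `Φ` with the trivial star on `Φ`. -/

/-- A `*`-ideal of the `Φ`-algebra `A`: a two-sided algebra ideal stable under the involution. -/
structure StarIdeal (Φ A : Type*) [CommRing Φ] [NonUnitalRing A] [StarRing A] [Module Φ A] extends
    Submodule Φ A where
  mul_mem_left' : ∀ (a : A) {x : A}, x ∈ carrier → a * x ∈ carrier
  mul_mem_right' : ∀ (a : A) {x : A}, x ∈ carrier → x * a ∈ carrier
  star_mem' : ∀ {x : A}, x ∈ carrier → star x ∈ carrier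

section StarAlgebra

variable (Φ A : Type*) [CommRing Φ] [NonUnitalRing A] [StarRing A] [Module Φ A]

/-- `A` is `*`-prime: the product of two non-zero `*`-ideals is non-zero. -/
def IsStarPrimeAlgebra : Prop :=
  ∀ I J : StarIdeal Φ A, I.toSubmodule ≠ ⊥ → J.toSubmodule ≠ ⊥ →
    ∃ x ∈ I.toSubmodule, ∃ y ∈ J.toSubmodule, x * y ≠ 0

/-- `A` is `*`-semiprime: the square of a non-zero `*`-ideal is non-zero. -/
def IsStarSemiprimeAlgebra : Prop :=
  ∀ I : StarIdeal Φ A, I.toSubmodule ≠ ⊥ →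
    ∃ x ∈ I.toSubmodule, ∃ y ∈ I.toSubmodule, x * y ≠ 0

end StarAlgebra

namespace StarIdeal

variable {Φ A : Type*} [CommRing Φ] [NonUnitalRing A] [StarRing A] [Module Φ A]

/-- The quotient algebra `A / I`. -/
def Quot (I : StarIdeal Φ A) : Type _ := A ⧸ I.toSubmodule

variable (I : StarIdeal Φ A)

instance : AddCommGroup I.Quot := inferInstanceAs (AddCommGroup (A ⧸ I.toSubmodule))

instance : Module Φ I.Quot := inferInstanceAs (Module Φ (A ⧸ I.toSubmodule))

/-- The quotient map `A → A / I`. -/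
def toQuot : A →ₗ[Φ] I.Quot := I.toSubmodule.mkQ

theorem toQuot_surjective : Function.Surjective I.toQuot := Submodule.mkQ_surjective _

theorem toQuot_eq_iff {x y : A} : I.toQuot x = I.toQuot y ↔ x - y ∈ I.toSubmodule :=
  Submodule.Quotient.eq _

instance : Mul I.Quot :=
  ⟨Quotient.map₂ (· * ·) (by
    intro a b hab c d hcd
    have h₁ : a - b ∈ I.toSubmodule := (Submodule.quotientRel_def _).1 hab
    have h₂ : c - d ∈ I.toSubmodule := (Submodule.quotientRel_def _).1 hcd
    refine (Submodule.quotientRel_def _).2 ?_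
    have : a * c - b * d = a * (c - d) + (a - b) * d := by rw [mul_sub, sub_mul]; abel
    rw [this]
    exact add_mem (I.mul_mem_left' a h₂) (I.mul_mem_right' d h₁))⟩

instance : Star I.Quot :=
  ⟨Quotient.map star (by
    intro a b hab
    have h₁ : a - b ∈ I.toSubmodule := (Submodule.quotientRel_def _).1 hab
    refine (Submodule.quotientRel_def _).2 ?_
    rw [← star_sub]
    exact I.star_mem' h₁)⟩

theorem toQuot_mul (a b : A) : I.toQuot (a * b) = I.toQuot a * I.toQuot b := rfl

theorem toQuot_star (a : A) : I.toQuot (star a) = star (I.toQuot a) := rfl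

instance : NonUnitalRing I.Quot :=
  { (inferInstance : AddCommGroup I.Quot), (inferInstance : Mul I.Quot) with
    mul_assoc := by
      intro a b c
      obtain ⟨a, rfl⟩ := I.toQuot_surjective a
      obtain ⟨b, rfl⟩ := I.toQuot_surjective b
      obtain ⟨c, rfl⟩ := I.toQuot_surjective c
      simp only [← toQuot_mul, mul_assoc]
    zero_mul := by
      intro a
      obtain ⟨a, rfl⟩ := I.toQuot_surjective a
      rw [← map_zero I.toQuot, ← toQuot_mul, zero_mul]
    mul_zero := by
      intro a
      obtain ⟨a, rfl⟩ := I.toQuot_surjective a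
      rw [← map_zero I.toQuot, ← toQuot_mul, mul_zero]
    left_distrib := by
      intro a b c
      obtain ⟨a, rfl⟩ := I.toQuot_surjective a
      obtain ⟨b, rfl⟩ := I.toQuot_surjective b
      obtain ⟨c, rfl⟩ := I.toQuot_surjective c
      rw [← map_add, ← toQuot_mul, mul_add, map_add, toQuot_mul, toQuot_mul]
    right_distrib := by
      intro a b c
      obtain ⟨a, rfl⟩ := I.toQuot_surjective a
      obtain ⟨b, rfl⟩ := I.toQuot_surjective b
      obtain ⟨c, rfl⟩ := I.toQuot_surjective c
      rw [← map_add, ← toQuot_mul, add_mul, map_add, toQuot_mul, toQuot_mul] }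

instance : StarRing I.Quot where
  star_involutive := by
    intro a
    obtain ⟨a, rfl⟩ := I.toQuot_surjective a
    rw [← toQuot_star, ← toQuot_star, star_star]
  star_mul := by
    intro a b
    obtain ⟨a, rfl⟩ := I.toQuot_surjective a
    obtain ⟨b, rfl⟩ := I.toQuot_surjective b
    rw [← toQuot_star, ← toQuot_star, ← toQuot_mul, ← toQuot_star, star_mul, toQuot_mul]
  star_add := by
    intro a b
    obtain ⟨a, rfl⟩ := I.toQuot_surjective a
    obtain ⟨b, rfl⟩ := I.toQuot_surjective b
    rw [← toQuot_star, ← toQuot_star, ← map_add, ← toQuot_star, star_add, map_add]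

/-- The ideal `I` is `*`-prime: it is a proper `*`-ideal and `A / I` is a `*`-prime algebra. -/
def IsStarPrime : Prop := I.toSubmodule ≠ ⊤ ∧ IsStarPrimeAlgebra Φ I.Quot

end StarIdeal

/-! ### Derivations and the Lie algebra `SDer(A)` -/

attribute [local instance 100] LieRing.ofAssociativeRing

/-- A Lie ring is strongly non-degenerate if it has no non-zero absolute zero divisor. -/
def StronglyNondegenerate (L : Type*) [LieRing L] : Prop :=
  ∀ x : L, (∀ y : L, ⁅x, ⁅x, y⁆⁆ = 0) → x = 0

section Derivations

variable (Φ A : Type*) [CommRing Φ] [NonUnitalRing A] [Module Φ A] [IsScalarTower Φ A A]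
  [SMulCommClass Φ A A]

/-- The Lie algebra of all (associative, `Φ`-linear) derivations of `A`. -/
def Der : LieSubalgebra Φ (Module.End Φ A) where
  carrier := {δ | ∀ x y : A, δ (x * y) = δ x * y + x * δ y}
  zero_mem' := by intro x y; simp
  add_mem' := by
    intro δ μ hδ hμ x y
    simp only [LinearMap.add_apply, hδ x y, hμ x y, add_mul, mul_add]
    abel
  smul_mem' := by
    intro c δ hδ x y
    simp only [LinearMap.smul_apply, hδ x y, smul_add, smul_mul_assoc, mul_smul_comm]
  lie_mem' := by
    intro δ μ hδ hμ x y
    have h : ∀ z, ⁅δ, μ⁆ z = δ (μ z) - μ (δ z) := fun z => rfl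
    rw [h, h, h, hμ x y, hδ x y, map_add, map_add, hδ, hδ, hμ, hμ, sub_mul, mul_sub]
    abel

theorem Der.map_center (δ : Der Φ A) {z : A} (hz : z ∈ NonUnitalSubring.center A) :
    δ.1 z ∈ NonUnitalSubring.center A := by
  rw [NonUnitalSubring.mem_center_iff] at hz ⊢
  intro a
  have h := congrArg δ.1 (hz a)
  rw [δ.2, δ.2, hz (δ.1 a), add_comm (δ.1 z * a)] at h
  exact add_left_cancel h

variable [StarRing A] [Star Φ] [TrivialStar Φ] [StarModule Φ A]

/-- The Lie algebra of all derivations of `A` that commute with the involution. -/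
def SDer : LieSubalgebra Φ (Der Φ A) where
  carrier := {δ | ∀ x : A, δ.1 (star x) = star (δ.1 x)}
  zero_mem' := by intro x; simp
  add_mem' := by
    intro δ μ hδ hμ x
    change δ.1 (star x) + μ.1 (star x) = star (δ.1 x + μ.1 x)
    rw [hδ x, hμ x, star_add]
  smul_mem' := by
    intro c δ hδ x
    change c • δ.1 (star x) = star (c • δ.1 x)
    rw [hδ x, star_smul, star_trivial c]
  lie_mem' := by
    intro δ μ hδ hμ x
    change δ.1 (μ.1 (star x)) - μ.1 (δ.1 (star x)) = star (δ.1 (μ.1 x) - μ.1 (δ.1 x))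
    rw [hμ x, hδ x, hδ, hμ, star_sub]

/-- The Lie ideal `{δ ∈ SDer(A) | δ(K) ⊆ Z(A)}`, where `K` is the set of skew elements of `A` and
`Z(A)` is the associative center of `A`. -/
def skewToCenterIdeal : LieIdeal Φ (SDer Φ A) where
  carrier := {δ | ∀ k ∈ skewAdjoint A, δ.1.1 k ∈ NonUnitalSubring.center A}
  zero_mem' := fun k _ => zero_mem (NonUnitalSubring.center A)
  add_mem' := fun hδ hμ k hk => add_mem (hδ k hk) (hμ k hk)
  smul_mem' := by
    intro c δ hδ k hk
    exact hδ (c • k) (skewAdjoint.smul_mem c hk) |> fun h => by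
      rw [map_smul] at h; exact h
  lie_mem := by
    intro μ δ hδ k hk
    change μ.1.1 (δ.1.1 k) - δ.1.1 (μ.1.1 k) ∈ NonUnitalSubring.center A
    refine sub_mem (Der.map_center Φ A μ.1 (hδ k hk)) (hδ _ ?_)
    rw [skewAdjoint.mem_iff] at hk ⊢
    rw [← μ.2 k, hk, map_neg]

end Derivations

/-- The center `Z(K)` of the Lie algebra `K` of skew elements of `A`. -/
def skewCenter (A : Type*) [NonUnitalRing A] [StarRing A] : Set A :=
  {x | x ∈ skewAdjoint A ∧ ∀ y ∈ skewAdjoint A, x * y - y * x = 0}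

/-! The Lie-theoretic part is a symmetric cubic form. If `[x, [x, L]] = 0` in a Lie ring without
2-torsion, then `T(a, b, d) = [[x, a], [[x, b], d]]` is symmetric in its three arguments, and every
`T(a, a, a)` is again an absolute zero divisor (`absolute_zero_lie_lie`). Apply this in
`SDer(A)/I_{K,Z}` to an absolute zero divisor `δ` and to `a = ad k` with `k` skew. Since `[δ, ad k]
= ad δ(k)`, the value `T(a, a, a)` is `ad τ` with `τ = [δk, [δk, k]]`. By the associative theorem
`central_of_lie_lie_skew_central` (a skew `c` with `[c, [c, K]]` central is itself central), `τ` is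
central, so `T` vanishes on the diagonal of `ad K`. As 6 is invertible, polarization makes `[δk,
[δk, l]]` central for all skew `l`; the same theorem shows that `δk` is central, that is, `δ ∈
I_{K,Z}`. Moreover `I_{K,Z} = 0` (`SDer.eq_zero_of_skew_central`), so the conclusion passes from the
quotient to `SDer(A)`.

The associative statements are checked in the quotients by `*`-prime ideals, whose intersection is
zero. In such a quotient `B`, if `[c, [c, K]]` is central then it is zero, and then `c` commutes
with `K`. A derivation that commutes with `*` and kills `K` must vanish as soon as `[u², v] ≠ 0` for
some skew `u`, `v`, because `[u², v] B d(B) = 0`. The degree hypothesis supplies such `u`, `v`. If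
all `[u², v]` vanished, squares of skew elements would be central, and a trace computation would
give `[x², y] z [x, w] = [x, y] z [x², w]` (`degree_identity`). Then `[x, y] ↦ [x², y]` is
multiplication by some `λ` in the extended centroid, `μ = x² - λx` is central too, and every `x` is
a root of `X² - λX - μ`. -/

section AbsoluteZeroDivisors

/-! ### Absolute zero divisors of a Lie ring and their symmetric cubic form -/

variable {L : Type*} [LieRing L]

/-- For an absolute zero divisor `x`, the elements of `[x, L]` commute. -/
theorem lie_lie_of_absolute_zero (h2 : ∀ y : L, y + y = 0 → y = 0) {x : L}
    (hx : ∀ y : L, ⁅x, ⁅x, y⁆⁆ = 0) (a b : L) : ⁅⁅x, a⁆, ⁅x, b⁆⁆ = 0 := by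
  apply h2
  have h := hx ⁅a, b⁆
  rw [leibniz_lie x a b, lie_add, leibniz_lie x ⁅x, a⁆ b, leibniz_lie x a ⁅x, b⁆, hx, hx] at h
  simpa using h

theorem triple_comm_left (h2 : ∀ y : L, y + y = 0 → y = 0) {x : L}
    (hx : ∀ y : L, ⁅x, ⁅x, y⁆⁆ = 0) (a b d : L) :
    ⁅⁅x, a⁆, ⁅⁅x, b⁆, d⁆⁆ = ⁅⁅x, b⁆, ⁅⁅x, a⁆, d⁆⁆ := by
  rw [leibniz_lie ⁅x, a⁆ ⁅x, b⁆ d, lie_lie_of_absolute_zero h2 hx, zero_lie, zero_add]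

/-- The commutator of `[x, a]` with `[x, [b, d]] = [[x, b], d] - [[x, d], b]` is zero. Together with
`triple_comm_left` this makes `T(a, b, d) = [[x, a], [[x, b], d]]` symmetric in all three arguments.
-/
theorem triple_comm_right (h2 : ∀ y : L, y + y = 0 → y = 0) {x : L}
    (hx : ∀ y : L, ⁅x, ⁅x, y⁆⁆ = 0) (a b d : L) :
    ⁅⁅x, a⁆, ⁅⁅x, b⁆, d⁆⁆ = ⁅⁅x, a⁆, ⁅⁅x, d⁆, b⁆⁆ := by
  have h := lie_lie_of_absolute_zero h2 hx a ⁅b, d⁆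
  rw [leibniz_lie x b d, ← lie_skew b ⁅x, d⁆, lie_add, lie_neg] at h
  exact eq_of_sub_eq_zero (by rw [sub_eq_add_neg]; exact h)

/-- If `x` is an absolute zero divisor and `c = [x, a]`, then `[c, [c, a]]` is an absolute zero
divisor as well. -/
theorem absolute_zero_lie_lie (h2 : ∀ y : L, y + y = 0 → y = 0) {x : L}
    (hx : ∀ y : L, ⁅x, ⁅x, y⁆⁆ = 0) (a y : L) :
    ⁅⁅⁅x, a⁆, ⁅⁅x, a⁆, a⁆⁆, ⁅⁅⁅x, a⁆, ⁅⁅x, a⁆, a⁆⁆, y⁆⁆ = 0 := by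
  have hcc := lie_lie_of_absolute_zero h2 hx
  have hl := triple_comm_left h2 hx
  have hr := triple_comm_right h2 hx
  obtain ⟨h, hh⟩ : ∃ h, h = ⁅⁅x, a⁆, a⁆ := ⟨_, rfl⟩
  rw [← hh]
  have hxh : ⁅x, h⁆ = 0 := by
    rw [hh, leibniz_lie x ⁅x, a⁆ a, hx, hcc]; simp
  have hmove : ∀ e : L, ⁅x, ⁅h, e⁆⁆ = ⁅h, ⁅x, e⁆⁆ := by
    intro e; rw [leibniz_lie x h e, hxh]; simp
  -- Since `ad h` commutes with `ad x`, it acts as a derivation on the form `T`.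
  have hder : ∀ p q r : L, ⁅h, ⁅⁅x, p⁆, ⁅⁅x, q⁆, r⁆⁆⁆ = ⁅⁅x, ⁅h, p⁆⁆, ⁅⁅x, q⁆, r⁆⁆ +
      ⁅⁅x, p⁆, ⁅⁅x, ⁅h, q⁆⁆, r⁆⁆ + ⁅⁅x, p⁆, ⁅⁅x, q⁆, ⁅h, r⁆⁆⁆ := by
    intro p q r
    rw [leibniz_lie h ⁅x, p⁆, leibniz_lie h ⁅x, q⁆ r, lie_add, hmove, hmove, add_assoc]
  -- By symmetry `T(a, a, e) = T(e, a, a) = [[x, e], h]`.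
  have hN : ∀ e : L, ⁅⁅x, a⁆, ⁅⁅x, a⁆, e⁆⁆ = -⁅h, ⁅x, e⁆⁆ := by
    intro e
    rw [hr a a e, hl a e a, ← hh, lie_skew]
  obtain ⟨u, hu⟩ : ∃ u, u = ⁅a, h⁆ := ⟨_, rfl⟩
  have hau : ⁅h, a⁆ = -u := by rw [hu, lie_skew]
  have hxu : ⁅x, u⁆ = ⁅⁅x, a⁆, h⁆ := by rw [hu, leibniz_lie x a h, hxh]; simp
  rw [← hxu]
  -- `T(u, a, e) = 0`: in the derivation rule for `T(a, a, e)` the left side and the term `T(a, a,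
  -- [h, e])` are both `-[h, [h, [x, e]]]`, which leaves `2 T(u, a, e) = 0`.
  have hua : ∀ e : L, ⁅⁅x, u⁆, ⁅⁅x, a⁆, e⁆⁆ = 0 := by
    intro e
    apply h2
    have h1 := hder a a e
    rw [hN ⁅h, e⁆, hN e, hau, hmove e, lie_neg, lie_neg, neg_lie, neg_lie, lie_neg, hl a u e] at h1
    rw [← sub_eq_zero.2 h1]; abel
  -- In the derivation rule for `T(u, a, y) = 0` only the term with `[h, a] = -u` survives, so `T(u,
  -- u, y) = 0`; this is the goal because `[x, u] = [[x, a], h]`.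
  have h1 := hder u a y
  have hhu : ⁅h, ⁅x, u⁆⁆ = 0 := by
    have h3 := hN u
    rw [hr a a u, hl a u a, hua] at h3
    exact neg_eq_zero.1 h3.symm
  rw [hua, hmove, hhu, hua, hau, lie_zero, zero_lie, zero_add, add_zero, lie_neg, neg_lie,
    lie_neg] at h1
  exact neg_eq_zero.1 h1.symm

/-- Polarization of `[c, [c, a]] = 0`, where `c = [x, a]`. -/
theorem lie_lie_eq_zero_of_cubic (h2 : ∀ y : L, y + y = 0 → y = 0)
    (h3 : ∀ y : L, y + y + y = 0 → y = 0) {x : L}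
    (hx : ∀ y : L, ⁅x, ⁅x, y⁆⁆ = 0) {S : AddSubgroup L}
    (hS : ∀ a ∈ S, ⁅⁅x, a⁆, ⁅⁅x, a⁆, a⁆⁆ = 0) {a b : L} (ha : a ∈ S) (hb : b ∈ S) :
    ⁅⁅x, a⁆, ⁅⁅x, a⁆, b⁆⁆ = 0 := by
  have hl := triple_comm_left h2 hx
  have hr := triple_comm_right h2 hx
  -- The cubes of `a + b` and `a - b` give `3T(a,a,b) + 3T(a,b,b) = 0` and `-3T(a,a,b) + 3T(a,b,b) =
  -- 0`; their difference is `6 T(a,a,b)`.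
  have e1 := hS _ (add_mem ha hb)
  have e2 := hS _ (sub_mem ha hb)
  simp only [lie_add, add_lie, lie_sub, sub_lie, hS a ha, hS b hb] at e1 e2
  rw [hl b a a, hr a b a, hl b a b] at e1 e2
  obtain ⟨p, hp⟩ : ∃ p, p = ⁅⁅x, a⁆, ⁅⁅x, a⁆, b⁆⁆ := ⟨_, rfl⟩
  rw [← hp] at e1 e2 ⊢
  apply h3
  apply h2
  calc _ = _ := by abel
    _ = _ := congrArg₂ (· - ·) e1 e2
    _ = 0 := sub_zero 0

end AbsoluteZeroDivisors

/-! ### Identities in semiprime and `*`-prime rings -/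

section Semiprime

/-- Elementwise form of semiprimeness. -/
def IsElementwiseSemiprime (B : Type*) [NonUnitalRing B] : Prop :=
  ∀ a : B, (∀ x : B, a * x * a = 0) → a = 0

variable {B : Type*} [NonUnitalRing B]

namespace IsElementwiseSemiprime

theorem eq_zero_of_cube (hB : IsElementwiseSemiprime B) {a : B}
    (h : ∀ x y : B, a * x * a * y * a = 0) : a = 0 := by
  refine hB a fun x => hB _ fun y => ?_
  have : a * x * a * y * (a * x * a) = a * x * a * y * a * (x * a) := by simp only [mul_assoc]
  rw [this, h, zero_mul]

theorem mul_mul_comm_eq_zero (hB : IsElementwiseSemiprime B) {a b : B}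
    (h : ∀ x : B, a * x * b = 0) (x : B) : b * x * a = 0 := by
  refine hB _ fun y => ?_
  have : b * x * a * y * (b * x * a) = b * x * (a * y * b) * (x * a) := by simp only [mul_assoc]
  rw [this, h, mul_zero, zero_mul]

/-- A central nilpotent element (of index at most three) vanishes. -/
theorem eq_zero_of_central_cube (hB : IsElementwiseSemiprime B) {z : B}
    (hz : ∀ x, z * x = x * z) (h : z * z * z = 0) : z = 0 := by
  refine hB.eq_zero_of_cube fun x y => ?_
  have : z * x * z * y * z = x * (z * z * z) * y := by
    rw [hz x]
    simp only [mul_assoc]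
    rw [← hz y]
  rw [this, h, mul_zero, zero_mul]

/-- With `d = ad g` and `d² = 0`, expanding `d²(xy)` gives `2 d(x) d(y) = 0`; replacing `y` by `yx`
turns this into `d(x) y d(x) = 0`. -/
theorem central_of_lie_lie (hB : IsElementwiseSemiprime B) (h2 : ∀ x : B, x + x = 0 → x = 0)
    {g : B} (hg : ∀ x : B, g * (g * x - x * g) - (g * x - x * g) * g = 0) (x : B) :
    g * x = x * g := by
  have key : ∀ x y : B, (g * x - x * g) * (g * y - y * g) = 0 := by
    intro x y
    apply h2
    have e1 := hg (x * y)
    have e2 : (g * (g * x - x * g) - (g * x - x * g) * g) * y = 0 := by rw [hg x, zero_mul]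
    have e3 : x * (g * (g * y - y * g) - (g * y - y * g) * g) = 0 := by rw [hg y, mul_zero]
    have e : (g * x - x * g) * (g * y - y * g) + (g * x - x * g) * (g * y - y * g) =
        (g * (g * (x * y) - x * y * g) - (g * (x * y) - x * y * g) * g) -
        (g * (g * x - x * g) - (g * x - x * g) * g) * y -
        x * (g * (g * y - y * g) - (g * y - y * g) * g) := by noncomm_ring
    rw [e, e1, e2, e3, sub_zero, sub_zero]
  refine sub_eq_zero.1 (hB _ fun y => ?_)
  have e := key x (y * x)
  have e' : (g * x - x * g) * (g * y - y * g) * x = 0 := by rw [key, zero_mul]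
  rw [← sub_eq_zero.2 (e.trans e'.symm)]
  noncomm_ring

/-- If `c³ x - c² x c - c x c² + x c³ = 0` for all `x`, then `c²` is central. -/
theorem sq_central_of_identity (hB : IsElementwiseSemiprime B)
    (h2 : ∀ x : B, x + x = 0 → x = 0) {c : B}
    (hc : ∀ x : B, c * c * c * x - c * c * x * c - c * x * (c * c) + x * (c * c * c) = 0) (w : B) :
    c * c * w = w * (c * c) := by
  -- The hypothesis says `[c, [c², x]] = 0`. Evaluating it on `w x y` and removing the instances for
  -- `x y`, `w x` and `x` yields this exchange rule, in which the square moves between the brackets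
  -- at the cost of a sign.
  have key : ∀ w x y : B, (c * c * w - w * (c * c)) * x * (c * y - y * c) =
      -((c * w - w * c) * x * (c * c * y - y * (c * c))) := by
    intro w x y
    have e1 := hc (w * x * y)
    have e2 : w * (c * c * c * (x * y) - c * c * (x * y) * c - c * (x * y) * (c * c) +
      (x * y) * (c * c * c)) = 0 := by rw [hc, mul_zero]
    have e3 : (c * c * c * (w * x) - c * c * (w * x) * c - c * (w * x) * (c * c) +
      (w * x) * (c * c * c)) * y = 0 := by rw [hc, zero_mul]
    have e4 : w * (c * c * c * x - c * c * x * c - c * x * (c * c) + x * (c * c * c)) * y = 0 := by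
      rw [hc, mul_zero, zero_mul]
    rw [← sub_eq_zero, sub_neg_eq_add]
    have e : 0 - 0 - 0 + 0 = (0 : B) := by abel
    rw [← e]
    nth_rw 1 [← e1]
    nth_rw 1 [← e2]
    nth_rw 1 [← e3]
    nth_rw 1 [← e4]
    noncomm_ring
  -- Moving the square from the first bracket to the last in one jump gives one sign, by way of the
  -- middle bracket two signs; so twice the product is zero.
  have key2 : ∀ w x y z v : B, (c * c * w - w * (c * c)) * x * (c * y - y * c) * z *
      (c * v - v * c) = 0 := by
    intro w x y z v
    apply h2
    have e1 := key w (x * (c * y - y * c) * z) v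
    have e2 : (c * c * w - w * (c * c)) * x * (c * y - y * c) * z * (c * v - v * c) =
        (c * w - w * c) * (x * (c * y - y * c) * z) * (c * c * v - v * (c * c)) := by
      rw [key w x y]
      have e3 : (c * w - w * c) * x * ((c * c * y - y * (c * c)) * z * (c * v - v * c)) =
        (c * w - w * c) * x * -((c * y - y * c) * z * (c * c * v - v * (c * c))) := by
        rw [key y z v]
      simp only [neg_mul, mul_neg, mul_assoc] at e3 ⊢
      rw [e3, neg_neg]
    nth_rw 1 [e2]
    rw [← neg_eq_iff_add_eq_zero, ← e1]
    simp only [mul_assoc]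
  refine sub_eq_zero.1 (hB.eq_zero_of_cube fun x z => ?_)
  -- Substituting `[c², w] = c[c, w] + [c, w]c` into the last two factors of `a x a z a` reduces it
  -- to `key2`.
  have e : ∀ v, c * c * v - v * (c * c) = c * (c * v - v * c) + (c * v - v * c) * c := by
    intro v; noncomm_ring
  have e1 := key2 w (x * c) w (z * c) w
  have e2 := key2 w (x * c) w z w
  have e3 := key2 w x w (c * z * c) w
  have e4 := key2 w x w (c * z) w
  obtain ⟨a, ha⟩ : ∃ a, a = c * c * w - w * (c * c) := ⟨_, rfl⟩
  obtain ⟨b, hb⟩ : ∃ b, b = c * w - w * c := ⟨_, rfl⟩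
  have hab : a = c * b + b * c := by rw [ha, hb, e]
  rw [← ha, ← hb] at e1 e2 e3 e4
  rw [← ha]
  have : a * x * a * z * a = a * (x * c) * b * (z * c) * b + a * (x * c) * b * z * b * c +
      a * x * b * (c * z * c) * b + a * x * b * (c * z) * b * c := by
    nth_rw 2 3 [hab]
    simp only [mul_add, add_mul, mul_assoc]
    abel
  rw [this, e1, e2, e3, e4]
  simp

end IsElementwiseSemiprime

end Semiprime

/-! ### Skew elements of `*`-prime rings -/

section StarPrime

/-- Elementwise form of `*`-primeness, for rings without `2`- and `3`-torsion. -/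
structure IsElementwiseStarPrime (B : Type*) [NonUnitalRing B] [StarRing B] : Prop where
  semiprime : IsElementwiseSemiprime B
  prime : ∀ a b : B, (∀ x : B, a * x * b = 0) → (∀ x : B, a * x * star b = 0) → a = 0 ∨ b = 0
  two : ∀ x : B, x + x = 0 → x = 0
  three : ∀ x : B, x + x + x = 0 → x = 0

variable {B : Type*} [NonUnitalRing B] [StarRing B]

theorem star_anticomm_of_skew {k h : B} (hk : star k = -k) (hh : star h = h) :
    star (k * h + h * k) = -(k * h + h * k) := by
  simp only [star_add, star_mul, hk, hh]; noncomm_ring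

theorem star_commutator_of_skew {k l : B} (hk : star k = -k) (hl : star l = -l) :
    star (k * l - l * k) = -(k * l - l * k) := by
  simp only [star_sub, star_mul, hk, hl]; noncomm_ring

theorem star_mul_mul_of_skew {k l : B} (hk : star k = -k) (hl : star l = -l) :
    star (k * l * k) = -(k * l * k) := by
  simp only [star_mul, hk, hl]; noncomm_ring

/-- A derivation that vanishes on the skew elements annihilates `[u², v]` for skew `u`, `v`. -/
theorem commutator_mul_derivation_eq_zero (h2 : ∀ x : B, x + x = 0 → x = 0) (d : B →+ B)
    (hd : ∀ x y, d (x * y) = d x * y + x * d y) (hdK : ∀ k : B, star k = -k → d k = 0)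
    {u v : B} (hu : star u = -u) (hv : star v = -v) (r : B) :
    (u * u * v - v * (u * u)) * d r = 0 := by
  have du := hdK u hu
  have dv := hdK v hv
  -- `[u², h] = [u, uh + hu]` with `uh + hu` skew when `h` is symmetric, so `d` kills it; for skew
  -- `s` it kills every factor. Twice any element is a sum of a symmetric and a skew one.
  have key : ∀ s : B, d (u * u * s - s * (u * u)) = 0 := by
    intro s
    apply h2
    have hs : star (s + star s) = s + star s := by simp [add_comm]
    have hk : star (s - star s) = -(s - star s) := by simp
    have e1 := hdK _ (star_anticomm_of_skew hu hs)
    have e2 := hdK _ hk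
    have e : u * u * s - s * (u * u) + (u * u * s - s * (u * u)) =
        (u * (u * (s + star s) + (s + star s) * u) - (u * (s + star s) + (s + star s) * u) * u) +
        (u * u * (s - star s) - (s - star s) * (u * u)) := by noncomm_ring
    rw [← map_add, e, map_add, map_sub, map_sub, hd, hd _ u, hd, hd (s - star s), hd u u, e1, e2,
      du]
    simp
  have e : (u * u * v - v * (u * u)) * r =
      (u * u * (v * r) - v * r * (u * u)) - v * (u * u * r - r * (u * u)) := by noncomm_ring
  have e' := congrArg d e
  rw [hd, key, map_sub, key, hd, key, dv] at e'
  simpa using e'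

namespace IsElementwiseStarPrime

/-- A symmetric central element is regular. -/
theorem central_regular (hB : IsElementwiseStarPrime B) {s y : B} (hs : ∀ x, s * x = x * s)
    (hss : star s = s) (h : s * y = 0) : s = 0 ∨ y = 0 := by
  refine (hB.prime y s (fun x => ?_) fun x => ?_).symm
  · rw [← hs, ← mul_assoc, h, zero_mul]
  · rw [hss, ← hs, ← mul_assoc, h, zero_mul]

/-- If `[c, [c, K]]` is central, then it vanishes. -/
theorem lie_lie_eq_zero_of_central (hB : IsElementwiseStarPrime B) {c : B} (hc : star c = -c)
    (h : ∀ k : B, star k = -k → ∀ x, (c * (c * k - k * c) - (c * k - k * c) * c) * x =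
      x * (c * (c * k - k * c) - (c * k - k * c) * c)) {k : B} (hk : star k = -k) :
    c * (c * k - k * c) - (c * k - k * c) * c = 0 := by
  obtain ⟨u, hu⟩ : ∃ u, u = c * k - k * c := ⟨_, rfl⟩
  obtain ⟨z, hz⟩ : ∃ z, z = c * u - u * c := ⟨_, rfl⟩
  have hus : star u = -u := by rw [hu]; exact star_commutator_of_skew hc hk
  have hzc : ∀ x, z * x = x * z := by rw [hz, hu]; exact h k hk
  rw [← hu, ← hz]
  -- With `D = ad c` we have `Dk = u`, `Du = z`, `Dz = 0`. Testing the hypothesis on the skew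
  -- element `uku` gives the central element `D²(uku) = z(2kz + 5u²)`, and one further `D` gives `12
  -- z²u = 0`.
  have h1 := h _ (star_mul_mul_of_skew hus hk) c
  have d : ∀ x y : B, c * (x * y) - x * y * c = (c * x - x * c) * y + x * (c * y - y * c) := by
    intro x y; noncomm_ring
  have dz : c * z - z * c = 0 := by rw [hzc]; simp
  have e1 : c * (u * k * u) - u * k * u * c = z * (k * u) + u * u * u + u * k * z := by
    rw [d, d, ← hz, ← hu]; noncomm_ring
  have e2 : c * (z * (k * u) + u * u * u + u * k * z) - (z * (k * u) + u * u * u + u * k * z) * c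
      = z * (k * z + k * z + u * u + u * u + u * u + u * u + u * u) := by
    have : c * (z * (k * u) + u * u * u + u * k * z) - (z * (k * u) + u * u * u + u * k * z) * c
      = (c * z - z * c) * (k * u) + z * ((c * k - k * c) * u + k * (c * u - u * c)) +
        (((c * u - u * c) * u + u * (c * u - u * c)) * u + u * u * (c * u - u * c)) +
        (((c * u - u * c) * k + u * (c * k - k * c)) * z + u * k * (c * z - z * c)) := by
      noncomm_ring
    rw [this, dz, ← hz, ← hu]
    have f1 : u * z * u = z * (u * u) := by rw [← hzc, mul_assoc]
    have f2 : u * u * z = z * (u * u) := by rw [← hzc]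
    have f3 : z * k * z = z * (k * z) := mul_assoc _ _ _
    simp only [add_mul, mul_add, f1, f2, f3, zero_mul, mul_zero, mul_assoc]
    abel
  rw [e1, e2] at h1
  have h5 : (c * k - k * c) * z + (c * k - k * c) * z + ((c * u - u * c) * u + u * (c * u - u * c))
      + ((c * u - u * c) * u + u * (c * u - u * c)) + ((c * u - u * c) * u + u * (c * u - u * c))
      + ((c * u - u * c) * u + u * (c * u - u * c)) + ((c * u - u * c) * u + u * (c * u - u * c))
      = z * u + z * u + z * u + z * u + z * u + z * u + z * u + z * u + z * u + z * u + z * u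
        + z * u := by
    rw [← hz, ← hu, ← hzc u]; abel
  have h3 : z * (z * u) = 0 := by
    apply hB.three
    apply hB.two
    apply hB.two
    have e3 : z * (z * u + z * u + z * u + z * u + z * u + z * u + z * u + z * u + z * u + z * u
        + z * u + z * u) = 0 := by
      rw [← h5]
      have : z * ((c * k - k * c) * z + (c * k - k * c) * z +
          ((c * u - u * c) * u + u * (c * u - u * c))
      + ((c * u - u * c) * u + u * (c * u - u * c)) + ((c * u - u * c) * u + u * (c * u - u * c))
      + ((c * u - u * c) * u + u * (c * u - u * c)) + ((c * u - u * c) * u + u * (c * u - u * c)))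
        = (c * (z * (k * z + k * z + u * u + u * u + u * u + u * u + u * u)) -
          z * (k * z + k * z + u * u + u * u + u * u + u * u + u * u) * c)
          - (c * z - z * c) * (k * z + k * z + u * u + u * u + u * u + u * u + u * u)
          - z * k * (c * z - z * c) - z * k * (c * z - z * c) := by noncomm_ring
      rw [this, dz, h1]; simp
    rw [← e3]
    simp only [mul_add]
    abel
  refine hB.semiprime.eq_zero_of_central_cube hzc ?_
  -- Applying `D` to `z²u = 0` gives `z³ = 0`.
  have : z * z * z = c * (z * (z * u)) - z * (z * u) * c - (c * z - z * c) * (z * u) -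
      z * ((c * z - z * c) * u) := by
    nth_rw 3 [hz]; noncomm_ring
  rw [this, h3, dz]; simp

/-- If `[c, [c, K]] = 0`, then `c` commutes with `K`. -/
theorem commute_skew_of_lie_lie (hB : IsElementwiseStarPrime B) {c : B} (hc : star c = -c)
    (h : ∀ k : B, star k = -k → c * (c * k - k * c) - (c * k - k * c) * c = 0) {k : B}
    (hk : star k = -k) : c * k = k * c := by
  -- The left side is `[c, [c, cx + xc]]`. For symmetric `x` the element `cx + xc` is skew; for skew
  -- `x` the expression is `c y + y c` with `y = [c, [c, x]] = 0`.
  have hcube : ∀ x : B,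
      c * c * c * x - c * c * x * c - c * x * (c * c) + x * (c * c * c) = 0 := by
    intro x
    apply hB.two
    have hs : star (x + star x) = x + star x := by simp [add_comm]
    have hd : star (x - star x) = -(x - star x) := by simp
    have e1 := h _ (star_anticomm_of_skew hc hs)
    have e2 := h _ hd
    have e3 : c * (c * (c * (x - star x) - (x - star x) * c) -
        (c * (x - star x) - (x - star x) * c) * c) + (c * (c * (x - star x) - (x - star x) * c) -
        (c * (x - star x) - (x - star x) * c) * c) * c = 0 := by rw [e2]; simp
    rw [← add_zero 0]
    nth_rw 1 [← e1]
    rw [← e3]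
    noncomm_ring
  have hsq := hB.semiprime.sq_central_of_identity hB.two hcube
  have hckc : ∀ l : B, star l = -l → c * l * c = c * c * l := by
    intro l hl
    refine (sub_eq_zero.1 (hB.two _ ?_)).symm
    have : c * c * l - c * l * c + (c * c * l - c * l * c) =
        c * (c * l - l * c) - (c * l - l * c) * c + (c * c * l - l * (c * c)) := by noncomm_ring
    rw [this, h l hl, hsq, sub_self, add_zero]
  -- As `c²` is central and `ckc = c²k`, both `c²·ck` and `c²·kc` equal `ckc·c`.
  have hreg : c * c * (c * k - k * c) = 0 := by
    have e1 : c * c * (c * k) = c * k * c * c := by rw [hsq, ← mul_assoc]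
    rw [mul_sub, e1, hckc k hk, ← mul_assoc, sub_self]
  rcases hB.central_regular hsq (by simp [hc]) hreg with h0 | h0
  · suffices c = 0 by simp [this]
    -- If `c² = 0` then `c l c = 0` for skew `l`, so `*` is invisible between two copies of `c`.
    -- Applied to `x c y`, where `c* = -c`, this makes `cxcyc` alternating in `x` and `y`.
    have hsym : ∀ x : B, c * x * c = c * star x * c := by
      intro x
      have := hckc (x - star x) (by simp)
      rw [h0, zero_mul, mul_sub, sub_mul] at this
      exact sub_eq_zero.1 this
    have hanti : ∀ x y : B, c * x * c * y * c = -(c * y * c * x * c) := by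
      intro x y
      have e1 := hsym (x * c * y)
      simp only [star_mul, hc] at e1
      have e2 : c * (x * c * y) * c = c * x * c * y * c := by simp only [mul_assoc]
      rw [← e2, e1]
      have e3 : c * (star y * (-c * star x)) * c = -(c * star y * (c * star x * c)) := by
        noncomm_ring
      rw [e3, ← hsym x]
      have e4 : c * star y * (c * x * c) = c * star y * c * (x * c) := by simp only [mul_assoc]
      rw [e4, ← hsym y]; simp only [mul_assoc]
    refine hB.semiprime.eq_zero_of_cube fun x y => ?_
    -- Moving `x` past `y` and then past `w` costs two signs; moving it past `y c w` at once costs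
    -- one.
    have hall : ∀ x y w : B, c * x * c * y * c * w * c = 0 := by
      intro x y w
      apply hB.two
      have e1 := hanti x (y * c * w)
      have e2 : c * x * c * y * c * w * c = c * y * c * (w * c * x) * c := by
        have f1 : c * x * c * y * c * w * c = -(c * y * c * x * c * (w * c)) := by
          rw [mul_assoc _ w c, hanti x y, neg_mul]
        have f2 : c * y * c * x * c * (w * c) = c * y * (c * x * c * w * c) := by
          simp only [mul_assoc]
        rw [f1, f2, hanti x w, mul_neg, neg_neg]; simp only [mul_assoc]
      rw [← neg_eq_iff_add_eq_zero]
      nth_rw 2 [e2]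
      have f3 : c * x * c * y * c * w * c = c * x * c * (y * c * w) * c := by
        simp only [mul_assoc]
      rw [f3, e1]
      simp only [mul_assoc, neg_neg]
    refine hB.semiprime _ fun w => ?_
    have : c * x * c * y * c * w * (c * x * c * y * c) =
        c * x * c * y * c * w * c * (x * c * y * c) := by simp only [mul_assoc]
    rw [this, hall, zero_mul]
  · exact sub_eq_zero.1 h0

/-- An element commuting with all skew elements is central, unless the squares of skew elements
commute with all skew elements. -/
theorem central_of_commute_skew (hB : IsElementwiseStarPrime B) {c : B} (hc : star c = -c)
    (h : ∀ k : B, star k = -k → c * k = k * c) {u v : B} (hu : star u = -u) (hv : star v = -v)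
    (huv : u * u * v - v * (u * u) ≠ 0) (r : B) : c * r = r * c := by
  let d : B →+ B := AddMonoidHom.mulLeft c - AddMonoidHom.mulRight c
  have hd : ∀ x, d x = c * x - x * c := fun x => rfl
  have hder : ∀ x y, d (x * y) = d x * y + x * d y := by
    intro x y; rw [hd, hd, hd]; noncomm_ring
  have key := commutator_mul_derivation_eq_zero hB.two d hder
    (fun k hk => by rw [hd, h k hk, sub_self]) hu hv
  have key_mul : ∀ x r, (u * u * v - v * (u * u)) * x * d r = 0 := by
    intro x r
    have e := key (x * r)
    rw [hder, mul_add, ← mul_assoc, key, zero_mul, zero_add, ← mul_assoc] at e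
    exact e
  refine sub_eq_zero.1 ((hB.prime _ (d r) (fun x => key_mul x r) fun x => ?_).resolve_left huv)
  have : star (d r) = d (star r) := by
    rw [hd, hd, star_sub, star_mul, star_mul, hc]; noncomm_ring
  rw [this, key_mul]

/-- If `[c, [c, K]]` is central, then `c` is central, unless the squares of skew elements commute
with all skew elements. -/
theorem central_of_lie_lie_central (hB : IsElementwiseStarPrime B) {c : B} (hc : star c = -c)
    (h : ∀ k : B, star k = -k → ∀ x, (c * (c * k - k * c) - (c * k - k * c) * c) * x =
      x * (c * (c * k - k * c) - (c * k - k * c) * c)) {u v : B} (hu : star u = -u)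
    (hv : star v = -v) (huv : u * u * v - v * (u * u) ≠ 0) (r : B) : c * r = r * c :=
  hB.central_of_commute_skew hc (fun _ hk => hB.commute_skew_of_lie_lie hc
    (fun _ hl => hB.lie_lie_eq_zero_of_central hc h hl) hk) hu hv huv r

/-! ### Squares of skew elements commuting with `K`: every element is quadratic -/

theorem sq_skew_central (hB : IsElementwiseStarPrime B)
    (hK : ∀ u v : B, star u = -u → star v = -v → u * u * v = v * (u * u))
    {u : B} (hu : star u = -u) (x : B) : u * u * x = x * (u * u) := by
  refine hB.semiprime.central_of_lie_lie hB.two (fun x => ?_) x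
  apply hB.two
  -- For symmetric `h`, `[u², h] = [u, uh + hu]` is skew and so commutes with `u²`; this gives `[u²,
  -- [u², x]] = 0` for all `x`.
  have hs : star (x + star x) = x + star x := by simp [add_comm]
  have e1 := hK u _ hu (star_commutator_of_skew hu (star_anticomm_of_skew hu hs))
  have e2 := hK u (x - star x) hu (by simp)
  have : u * u * (u * u * x - x * (u * u)) - (u * u * x - x * (u * u)) * (u * u) +
      (u * u * (u * u * x - x * (u * u)) - (u * u * x - x * (u * u)) * (u * u)) =
      (u * u * (u * (u * (x + star x) + (x + star x) * u) -
        (u * (x + star x) + (x + star x) * u) * u) -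
      (u * (u * (x + star x) + (x + star x) * u) -
        (u * (x + star x) + (x + star x) * u) * u) * (u * u)) +
      (u * u * (u * u * (x - star x) - (x - star x) * (u * u)) -
        (u * u * (x - star x) - (x - star x) * (u * u)) * (u * u)) := by noncomm_ring
  rw [this, e1, e2]
  simp

theorem anticomm_skew_central (hB : IsElementwiseStarPrime B)
    (hK : ∀ u v : B, star u = -u → star v = -v → u * u * v = v * (u * u))
    {u v : B} (hu : star u = -u) (hv : star v = -v) (x : B) :
    (u * v + v * u) * x = x * (u * v + v * u) := by
  have e := hB.sq_skew_central hK (u := u + v) (by simp [hu, hv, add_comm]) x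
  have e1 := hB.sq_skew_central hK hu x
  have e2 := hB.sq_skew_central hK hv x
  have : (u * v + v * u) * x - x * (u * v + v * u) = ((u + v) * (u + v) * x -
      x * ((u + v) * (u + v))) - (u * u * x - x * (u * u)) - (v * v * x - x * (v * v)) := by
    noncomm_ring
  rw [← sub_eq_zero, this, e, e1, e2]; simp

/-- The anticommutator of `u` with the skew element `uh + hu` is central, and it equals `2(uhu +
u²h)` because `u²` is central. -/
theorem trace_central (hB : IsElementwiseStarPrime B)
    (hK : ∀ u v : B, star u = -u → star v = -v → u * u * v = v * (u * u))
    {u h : B} (hu : star u = -u) (hh : star h = h) (x : B) :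
    (u * h * u + u * u * h) * x = x * (u * h * u + u * u * h) := by
  have e := hB.anticomm_skew_central hK hu (star_anticomm_of_skew hu hh) x
  have e1 : u * (u * h + h * u) + (u * h + h * u) * u =
      (u * h * u + u * u * h) + (u * h * u + u * u * h) := by
    have := hB.sq_skew_central hK hu h
    calc _ = u * u * h + u * h * u + (u * h * u + h * (u * u)) := by noncomm_ring
      _ = _ := by rw [← this]; abel
  rw [e1] at e
  refine sub_eq_zero.1 (hB.two _ ?_)
  rw [← sub_eq_zero.2 e]; noncomm_ring

theorem mul_anticomm (hB : IsElementwiseStarPrime B)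
    (hK : ∀ u v : B, star u = -u → star v = -v → u * u * v = v * (u * u))
    {u h : B} (hu : star u = -u) :
    u * u * (u * h + h * u) = (u * h * u + u * u * h) * u := by
  have e1 := hB.sq_skew_central hK hu (u * h)
  have e2 : (u * h * u + u * u * h) * u = u * h * (u * u) + u * u * (h * u) := by noncomm_ring
  rw [e2, mul_add, e1]

/-- The key relation: `u² x² - a x` is central up to regular factors, provided that `k = x - x*`
satisfies the same trace relation with `h = x + x*` as `u` does. -/
theorem degree_identity_of_trace (hB : IsElementwiseStarPrime B)
    (hK : ∀ u v : B, star u = -u → star v = -v → u * u * v = v * (u * u))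
    {u x : B} (hu : star u = -u) (hu0 : u * u ≠ 0)
    (hk : u * u * ((x - star x) * (x + star x) + (x + star x) * (x - star x)) =
      (u * (x + star x) * u + u * u * (x + star x)) * (x - star x)) (y z w : B) :
    (x * x * y - y * (x * x)) * z * (x * w - w * x) =
      (x * y - y * x) * z * (x * x * w - w * (x * x)) := by
  obtain ⟨h, hh⟩ : ∃ h, h = x + star x := ⟨_, rfl⟩
  obtain ⟨k, hkd⟩ : ∃ k, k = x - star x := ⟨_, rfl⟩
  have hhs : star h = h := by rw [hh]; simp [add_comm]
  have hks : star k = -k := by rw [hkd]; simp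
  have hxx : x + x = h + k := by rw [hh, hkd]; abel
  rw [← hh, ← hkd] at hk
  obtain ⟨s, hs⟩ : ∃ s, s = u * u := ⟨_, rfl⟩
  obtain ⟨b, hb⟩ : ∃ b, b = u * h * u + u * u * h := ⟨_, rfl⟩
  have hsc : ∀ x, s * x = x * s := by rw [hs]; exact hB.sq_skew_central hK hu
  have hbc : ∀ x, b * x = x * b := by rw [hb]; exact hB.trace_central hK hu hhs
  have hss : star s = s := by rw [hs]; simp [hu]
  have hbs : star b = b := by
    rw [hb, star_add, star_mul (u * u) h, star_mul (u * h), star_mul u h, star_mul u u, hu, hhs,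
      neg_mul_neg, ← hB.sq_skew_central hK hu h]
    noncomm_ring
  have hbu := hB.mul_anticomm hK (h := h) hu
  rw [← hb, ← hs] at hk hbu
  -- `g = 2sh - b` is the trace-free part of `h`, scaled by `2s`: the relations for `u` and for `k`
  -- say exactly that `g` anticommutes with both.
  obtain ⟨g, hg⟩ : ∃ g, g = s * h + s * h - b := ⟨_, rfl⟩
  have hgs : star g = g := by rw [hg]; simp [hhs, hss, hbs, hsc]
  have hgu : u * g = -(g * u) := by
    rw [← sub_eq_zero, sub_neg_eq_add]
    have : u * g + g * u = (s * (u * h + h * u) - b * u) + (s * (u * h + h * u) - b * u) +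
        ((u * s - s * u) * (h + h)) + (b * u - u * b) := by rw [hg]; noncomm_ring
    rw [this, hbu, hsc u, hbc u]; simp
  have hgk : g * k + k * g = 0 := by
    have : g * k + k * g = (s * (k * h + h * k) - b * k) + (s * (k * h + h * k) - b * k) +
        ((k * s - s * k) * (h + h)) + (b * k - k * b) := by rw [hg]; noncomm_ring
    rw [this, hk, hsc k, hbc k]; simp
  have hggs : star (g * g) = g * g := by simp [hgs]
  -- As `u` commutes with `g²`, the central trace of `g²` is `2s g²`, and `s` is regular.
  have hgg : ∀ x, g * g * x = x * (g * g) := by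
    intro x
    have e := hB.trace_central hK hu hggs x
    have e1 : u * (g * g) * u + u * u * (g * g) = s * (g * g) + s * (g * g) := by
      have : u * (g * g) * u = g * g * (u * u) := by
        rw [← mul_assoc, hgu, neg_mul, mul_assoc g u g, hgu]; noncomm_ring
      rw [this, ← hB.sq_skew_central hK hu, ← hs]
    rw [e1] at e
    have e2 : s * (g * g * x - x * (g * g)) = 0 := by
      apply hB.two
      calc _ = (s * (g * g) + s * (g * g)) * x - (s * x + s * x) * (g * g) := by noncomm_ring
        _ = x * (s * (g * g) + s * (g * g)) - (x * s + x * s) * (g * g) := by rw [e, hsc x]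
        _ = 0 := by noncomm_ring
    exact sub_eq_zero.1 ((hB.central_regular hsc hss e2).resolve_left (hs ▸ hu0))
  -- `q = 2 s (x + x) - b` has central square
  obtain ⟨q, hq⟩ : ∃ q, q = s * (x + x) + s * (x + x) - b := ⟨_, rfl⟩
  have hqgk : q = g + (s * k + s * k) := by rw [hq, hxx, hg]; noncomm_ring
  have hkk := hB.sq_skew_central hK hks
  have hqq : ∀ y, q * q * y = y * (q * q) := by
    intro y
    have e : q * q = g * g + s * (s * (k * k)) + s * (s * (k * k)) + s * (s * (k * k)) +
        s * (s * (k * k)) := by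
      have e1 : s * k * (s * k) = s * (s * (k * k)) := by
        rw [mul_assoc, ← mul_assoc k, ← hsc k]; simp only [mul_assoc]
      have e2 : g * (s * k) + s * k * g = 0 := by
        have : g * (s * k) + s * k * g = s * (g * k + k * g) + (g * s - s * g) * k := by
          noncomm_ring
        rw [this, hgk, hsc g]; simp
      calc q * q = g * g + (g * (s * k) + s * k * g) + (g * (s * k) + s * k * g) +
          s * k * (s * k) + s * k * (s * k) + s * k * (s * k) + s * k * (s * k) := by
            rw [hqgk]; noncomm_ring
        _ = _ := by rw [e1, e2]; abel
    have e3 : s * (s * (k * k)) * y = y * (s * (s * (k * k))) := by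
      rw [mul_assoc, mul_assoc, hkk, ← mul_assoc s y, hsc y, ← mul_assoc s, ← mul_assoc s, hsc y]
      simp only [mul_assoc]
    rw [e]
    simp only [add_mul, mul_add, hgg y, e3]
  -- Here `q² = 16s²x² - 8sbx + b²` is central; taking the commutator with `y` and cancelling `8s`
  -- leaves `2s[x², y] = b[x, y]`.
  have hrel : ∀ y, s * (x * x * y - y * (x * x)) + s * (x * x * y - y * (x * x)) =
      b * (x * y - y * x) := by
    intro y
    have m1 : s * x * (s * x) = s * (s * (x * x)) := by
      rw [mul_assoc, ← mul_assoc x, ← hsc x]; simp only [mul_assoc]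
    have m2 : s * x * b = s * (b * x) := by rw [mul_assoc, ← hbc]
    have m3 : b * (s * x) = s * (b * x) := by rw [← mul_assoc, hbc s, mul_assoc]
    have e : q * q = 16 • (s * (s * (x * x))) - 8 • (s * (b * x)) + b * b := by
      calc q * q = 16 • (s * x * (s * x)) - 4 • (s * x * b) - 4 • (b * (s * x)) + b * b := by
            rw [hq]; noncomm_ring
        _ = _ := by rw [m1, m2, m3]; abel
    have e1 := hqq y
    rw [e] at e1
    have e2 : 8 • (s * (s * (x * x * y - y * (x * x)) + s * (x * x * y - y * (x * x)) -
        b * (x * y - y * x))) = ((16 • (s * (s * (x * x))) - 8 • (s * (b * x)) + b * b) * y -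
        y * (16 • (s * (s * (x * x))) - 8 • (s * (b * x)) + b * b)) -
        16 • (s * ((s * y - y * s) * (x * x))) -
        16 • ((s * y - y * s) * (s * (x * x))) + 8 • (s * ((b * y - y * b) * x)) +
        8 • ((s * y - y * s) * (b * x)) - (b * y - y * b) * b - b * (b * y - y * b) := by
      noncomm_ring
    rw [e1, hsc y, hbc y] at e2
    simp only [sub_self, mul_zero, zero_mul, smul_zero, add_zero] at e2
    have e3 : s * (s * (x * x * y - y * (x * x)) + s * (x * x * y - y * (x * x)) -
        b * (x * y - y * x)) = 0 := by
      apply hB.two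
      apply hB.two
      apply hB.two
      rw [← e2]; abel
    exact sub_eq_zero.1 ((hB.central_regular hsc hss e3).resolve_left (hs ▸ hu0))
  have hfin : s * ((x * x * y - y * (x * x)) * z * (x * w - w * x) -
      (x * y - y * x) * z * (x * x * w - w * (x * x))) = 0 := by
    apply hB.two
    have e1 : ∀ t, (x * y - y * x) * z * (s * t) = s * ((x * y - y * x) * z * t) := by
      intro t; rw [← mul_assoc, ← hsc, mul_assoc]
    calc _ = (s * (x * x * y - y * (x * x)) + s * (x * x * y - y * (x * x))) * z * (x * w - w * x)
          - (s * ((x * y - y * x) * z * (x * x * w - w * (x * x))) +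
            s * ((x * y - y * x) * z * (x * x * w - w * (x * x)))) := by noncomm_ring
      _ = b * (x * y - y * x) * z * (x * w - w * x) -
          (x * y - y * x) * z * (s * (x * x * w - w * (x * x)) +
            s * (x * x * w - w * (x * x))) := by rw [hrel, ← e1, ← mul_add]
      _ = b * ((x * y - y * x) * z) * (x * w - w * x) -
          (x * y - y * x) * z * b * (x * w - w * x) := by rw [hrel]; simp only [mul_assoc]
      _ = 0 := by rw [hbc, sub_self]
  exact sub_eq_zero.1 ((hB.central_regular hsc hss hfin).resolve_left (hs ▸ hu0))

/-- If the squares of skew elements commute with all skew elements, then every element is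
algebraic of degree at most two, in the form of an identity. -/
theorem degree_identity (hB : IsElementwiseStarPrime B)
    (hK : ∀ u v : B, star u = -u → star v = -v → u * u * v = v * (u * u))
    (x y z w : B) :
    (x * x * y - y * (x * x)) * z * (x * w - w * x) =
      (x * y - y * x) * z * (x * x * w - w * (x * x)) := by
  obtain ⟨h, hh⟩ : ∃ h, h = x + star x := ⟨_, rfl⟩
  obtain ⟨k, hkd⟩ : ∃ k, k = x - star x := ⟨_, rfl⟩
  have hhs : star h = h := by rw [hh]; simp [add_comm]
  have hks : star k = -k := by rw [hkd]; simp
  by_cases hk0 : k * k = 0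
  swap
  · refine hB.degree_identity_of_trace hK hks hk0 ?_ y z w
    rw [← hh, ← hkd]
    exact hB.mul_anticomm hK hks
  by_cases hex : ∃ u : B, star u = -u ∧ u * u ≠ 0
  swap
  · push Not at hex
    -- If all skew squares vanish, `u h u` is central and nilpotent for symmetric `h`, while `u l u
    -- = 0` for skew `l` follows from `(u + l)² = 0`. So `uBu = 0`; with no skew elements left, `*`
    -- is the identity and `B` is commutative.
    have hskew : ∀ u : B, star u = -u → u = 0 := by
      intro u hu
      have huu := hex u hu
      refine hB.semiprime u fun t => ?_
      apply hB.two
      have hts : star (t + star t) = t + star t := by simp [add_comm]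
      have e1 : u * (t + star t) * u = 0 := by
        refine hB.semiprime.eq_zero_of_central_cube (fun v => ?_) ?_
        · have := hB.trace_central hK hu hts v
          rwa [huu, zero_mul, add_zero] at this
        · have : u * (t + star t) * u * (u * (t + star t) * u) =
              u * (t + star t) * (u * u) * (t + star t) * u := by simp only [mul_assoc]
          rw [this, huu]; simp
      have e2 : u * (t - star t) * u = 0 := by
        have hex2 := hex _ (show star (u + (t - star t)) = -(u + (t - star t)) by
          simp [hu]; abel)
        have hex3 := hex (t - star t) (by simp)
        have e4 : u * (t - star t) * u = u * ((u + (t - star t)) * (u + (t - star t))) -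
            u * u * u - u * u * (t - star t) - u * ((t - star t) * (t - star t)) := by
          noncomm_ring
        rw [e4, hex2, huu, hex3]; simp
      rw [← add_zero 0]
      nth_rw 1 [← e1]
      rw [← e2]
      noncomm_ring
    have hsym : ∀ t : B, star t = t := fun t =>
      (sub_eq_zero.1 (hskew (t - star t) (by simp))).symm
    have hcomm : ∀ a b : B, a * b = b * a := by
      intro a b
      have := hsym (a * b)
      rw [star_mul, hsym, hsym] at this
      exact this.symm
    rw [hcomm y, sub_self, hcomm y, sub_self]; simp
  obtain ⟨u, hu, hu0⟩ := hex
  -- one of `k + u`, `k - u` has non-zero square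
  obtain ⟨u, hu, hu0, hw0⟩ : ∃ u : B, star u = -u ∧ u * u ≠ 0 ∧ (k + u) * (k + u) ≠ 0 := by
    by_contra! hcon
    have e1 := hcon u hu hu0
    have e2 := hcon (-u) (by simp [hu]) (by simpa using hu0)
    apply hu0
    apply hB.two
    have : u * u + u * u = (k + u) * (k + u) + (k + -u) * (k + -u) - k * k - k * k := by
      noncomm_ring
    rw [this, e1, e2, hk0]; simp
  refine hB.degree_identity_of_trace hK hu hu0 ?_ y z w
  rw [← hh, ← hkd]
  obtain ⟨v, hv⟩ : ∃ v, v = k + u := ⟨_, rfl⟩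
  have hvs : star v = -v := by rw [hv, star_add, hks, hu]; abel
  obtain ⟨s, hs⟩ : ∃ s, s = u * u := ⟨_, rfl⟩
  obtain ⟨b, hb⟩ : ∃ b, b = u * h * u + u * u * h := ⟨_, rfl⟩
  obtain ⟨s', hs'⟩ : ∃ s', s' = v * v := ⟨_, rfl⟩
  obtain ⟨b', hb'⟩ : ∃ b', b' = v * h * v + v * v * h := ⟨_, rfl⟩
  have hsc : ∀ x, s * x = x * s := by rw [hs]; exact hB.sq_skew_central hK hu
  have hsc' : ∀ x, s' * x = x * s' := by rw [hs']; exact hB.sq_skew_central hK hvs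
  have hbc : ∀ x, b * x = x * b := by rw [hb]; exact hB.trace_central hK hu hhs
  have hbc' : ∀ x, b' * x = x * b' := by rw [hb']; exact hB.trace_central hK hvs hhs
  have hss : star s = s := by rw [hs]; simp [hu]
  have hss' : star s' = s' := by rw [hs']; simp [hvs]
  have hs0 : s ≠ 0 := by rw [hs]; exact hu0
  have hs0' : s' ≠ 0 := by rw [hs', hv]; exact hw0
  have hu1 := hB.mul_anticomm hK (h := h) hu
  have hv1 := hB.mul_anticomm hK (h := h) hvs
  rw [← hb, ← hs] at hu1 ⊢
  rw [← hb', ← hs'] at hv1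
  have hkhk : k * h * k = 0 := by
    refine hB.semiprime.eq_zero_of_central_cube (fun t => ?_) ?_
    · have := hB.trace_central hK hks hhs t
      rwa [hk0, zero_mul, add_zero] at this
    · have : k * h * k * (k * h * k) = k * h * (k * k) * h * k := by simp only [mul_assoc]
      rw [this, hk0]; simp
  -- Difference of the relations for `v = k + u` and for `u`; the term in `u` is the obstruction to
  -- the relation for `k`.
  have e1 : s * (s' * (k * h + h * k)) = s * b' * k + (s * b' - s' * b) * u := by
    have : s * (s' * (k * h + h * k)) = s * (s' * (v * h + h * v)) - s' * (s * (u * h + h * u)) +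
        (s' * s - s * s') * (u * h + h * u) := by rw [hv]; noncomm_ring
    rw [this, hv1, hu1, hsc s', hv]; noncomm_ring
  have hcen : ∀ t, (s * b' - s' * b) * t = t * (s * b' - s' * b) := by
    intro t
    rw [sub_mul, mul_sub, mul_assoc, hbc', ← mul_assoc, hsc, mul_assoc s', hbc, ← mul_assoc s',
      hsc']
    simp only [mul_assoc]
  -- Left multiplication of `e1` by `k` kills everything but the obstruction, since `k² = 0` and
  -- `khk = 0`; a further factor `u` on the right produces `s = u²`.
  have e2 : (s * b' - s' * b) * (s * k) = 0 := by
    have f1 : k * (s * (s' * (k * h + h * k))) = 0 := by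
      rw [← mul_assoc, ← hsc, mul_assoc, ← mul_assoc k, ← hsc', mul_assoc, mul_add,
        ← mul_assoc k k, hk0, ← mul_assoc k, hkhk]
      simp
    have f2 : k * (s * b' * k) = 0 := by
      rw [mul_assoc s, hbc', ← mul_assoc s, hsc, mul_assoc k s, ← mul_assoc k k, hk0, zero_mul]
    rw [e1, mul_add, f2, zero_add, ← mul_assoc, ← hcen] at f1
    calc _ = (s * b' - s' * b) * k * u * u := by rw [hsc k, hs]; simp only [mul_assoc]
      _ = 0 := by rw [f1, zero_mul]
  have hcs : star (s * b' - s' * b) = s * b' - s' * b := by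
    have hbs : star b = b := by
      rw [hb, ← hs]; simp only [star_add, star_mul, hu, hhs, hss, hsc h]; noncomm_ring
    have hbs' : star b' = b' := by
      rw [hb', ← hs']; simp only [star_add, star_mul, hvs, hhs, hss', hsc' h]; noncomm_ring
    rw [star_sub, star_mul, star_mul, hss, hss', hbs, hbs', hsc, hsc']
  rcases hB.central_regular hcen hcs e2 with h0 | h0
  · rw [h0, zero_mul, add_zero, sub_eq_zero.1 h0] at e1
    refine sub_eq_zero.1 ((hB.central_regular (y := s * (k * h + h * k) - b * k) hsc' hss'
      ?_).resolve_left hs0')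
    calc _ = s' * s * (k * h + h * k) - s' * b * k := by noncomm_ring
      _ = 0 := by rw [hsc' s, mul_assoc, e1, sub_self]
  · have hk : k = 0 := (hB.central_regular hsc hss h0).resolve_left hs0
    rw [hk]; simp

end IsElementwiseStarPrime

end StarPrime

/-! ### Elements of degree at most two over the extended centroid -/

namespace Martindale

variable {B : Type*} [NonUnitalRing B]

/-- A bimodule homomorphism on a dense ideal represents an element of the extended centroid. -/
theorem mk_mem_center_of_left_linear (f : DenseMap B) {J : TwoSidedIdeal B} (hJ : IsDense J)
    (hf : IsHomOn J f.toFun) (hl : ∀ a ∈ J, ∀ y : B, f.toFun (y * a) = y * f.toFun a) :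
    (Quotient.mk _ f : RightQuotients B) ∈ Subring.center (RightQuotients B) := by
  refine (Subring.mem_center_iff (R := RightQuotients B)).2 ?_
  rintro ⟨g⟩
  obtain ⟨I, hI, hg⟩ := g.exists_hom
  refine RightQuotients.sound (prodIdeal I J) (prodIdeal_dense hI hJ) fun x hx => ?_
  change g.toFun (f.toFun x) = f.toFun (g.toFun x)
  have neg_hom : ∀ {J' : TwoSidedIdeal B} {φ : B → B}, IsHomOn J' φ → ∀ x ∈ J', φ (-x) = -φ x := by
    intro J' φ hφ x hx
    have h0 : φ x + φ (-x) = 0 := by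
      rw [← hφ.1 x hx _ (J'.neg_mem hx), add_neg_cancel, hφ.map_zero]
    exact eq_neg_of_add_eq_zero_right h0
  have key : x ∈ I ∧ x ∈ J ∧ f.toFun x ∈ I ∧ g.toFun x ∈ J ∧
      g.toFun (f.toFun x) = f.toFun (g.toFun x) := by
    refine AddSubgroup.closure_induction (p := fun x _ => x ∈ I ∧ x ∈ J ∧ f.toFun x ∈ I ∧
      g.toFun x ∈ J ∧ g.toFun (f.toFun x) = f.toFun (g.toFun x)) ?_ ?_ ?_ ?_ (mem_prodIdeal.1 hx)
    · rintro _ ⟨s, hs, t, ht, rfl⟩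
      refine ⟨I.mul_mem_right _ _ hs, J.mul_mem_left _ _ ht, ?_, ?_, ?_⟩
      · rw [hl t ht]; exact I.mul_mem_right _ _ hs
      · rw [hg.2 s hs]; exact J.mul_mem_left _ _ ht
      -- On products, `g(f(st)) = g(s f(t)) = g(s) f(t) = f(g(s) t) = f(g(st))`.
      · rw [hl t ht, hg.2 s hs, hg.2 s hs, hl t ht]
    · rw [hf.map_zero, hg.map_zero]
      exact ⟨I.zero_mem, J.zero_mem, I.zero_mem, J.zero_mem, hf.map_zero.symm⟩
    · rintro a b _ _ ⟨h1, h2, h3, h4, h5⟩ ⟨k1, k2, k3, k4, k5⟩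
      rw [hf.1 a h2 b k2, hg.1 a h1 b k1, hg.1 _ h3 _ k3, hf.1 _ h4 _ k4, h5, k5]
      exact ⟨I.add_mem h1 k1, J.add_mem h2 k2, I.add_mem h3 k3, J.add_mem h4 k4, rfl⟩
    · rintro a _ ⟨h1, h2, h3, h4, h5⟩
      rw [neg_hom hf a h2, neg_hom hg a h1, neg_hom hg _ h3, neg_hom hf _ h4, h5]
      exact ⟨I.neg_mem h1, J.neg_mem h2, I.neg_mem h3, J.neg_mem h4, rfl⟩
  exact key.2.2.2.2

/-! ### The multiplier sending `[x, y]` to `[x², y]` -/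

section Multiplier

variable (x : B)

/-- `b` is the value at `a` of the multiplier `[x, y] ↦ [x², y]`, extended by zero to the
annihilator of all `[x, y]`. -/
def IsMultiplierValue (a b : B) : Prop :=
  (∀ z w : B, b * z * (x * w - w * x) = a * z * (x * x * w - w * (x * x))) ∧
    ∀ t : B, (∀ z w : B, t * z * (x * w - w * x) = 0) → ∀ z : B, b * z * t = 0

variable {x}

/-- The first condition puts `b - b'` in the annihilator of the brackets, and the second says that
values are orthogonal to that annihilator, hence `(b - b') z (b - b') = 0`. -/
theorem IsMultiplierValue.unique (hB : IsElementwiseSemiprime B) {a b b' : B}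
    (h : IsMultiplierValue x a b) (h' : IsMultiplierValue x a b') : b = b' := by
  have h0 : ∀ z w : B, (b - b') * z * (x * w - w * x) = 0 := by
    intro z w
    rw [sub_mul, sub_mul, h.1, h'.1, sub_self]
  refine sub_eq_zero.1 (hB _ fun z => ?_)
  rw [sub_mul, sub_mul, h.2 _ h0, h'.2 _ h0, sub_self]

theorem IsMultiplierValue.zero : IsMultiplierValue x 0 0 := by
  constructor <;> simp

theorem IsMultiplierValue.add {a b a' b' : B} (h : IsMultiplierValue x a b)
    (h' : IsMultiplierValue x a' b') : IsMultiplierValue x (a + a') (b + b') := by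
  refine ⟨fun z w => ?_, fun t ht z => ?_⟩
  · simp only [add_mul, h.1, h'.1]
  · simp only [add_mul, h.2 t ht, h'.2 t ht, add_zero]

theorem IsMultiplierValue.neg {a b : B} (h : IsMultiplierValue x a b) :
    IsMultiplierValue x (-a) (-b) := by
  refine ⟨fun z w => ?_, fun t ht z => ?_⟩
  · simp only [neg_mul, h.1]
  · simp only [neg_mul, h.2 t ht, neg_zero]

theorem IsMultiplierValue.mul_left {a b : B} (h : IsMultiplierValue x a b) (y : B) :
    IsMultiplierValue x (y * a) (y * b) := by
  refine ⟨fun z w => ?_, fun t ht z => ?_⟩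
  · rw [mul_assoc y b, mul_assoc y, h.1, mul_assoc y a, mul_assoc y]
  · rw [mul_assoc y b, mul_assoc y, h.2 t ht, mul_zero]

theorem IsMultiplierValue.mul_right {a b : B} (h : IsMultiplierValue x a b) (y : B) :
    IsMultiplierValue x (a * y) (b * y) := by
  refine ⟨fun z w => ?_, fun t ht z => ?_⟩
  · rw [mul_assoc b, h.1, ← mul_assoc a]
  · rw [mul_assoc b, h.2 t ht]

variable (x) in
/-- The ideal on which the multiplier is defined. -/
def multiplierIdeal : TwoSidedIdeal B :=
  TwoSidedIdeal.mk' {a | ∃ b, IsMultiplierValue x a b} ⟨0, .zero⟩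
    (fun ⟨_, h⟩ ⟨_, h'⟩ => ⟨_, h.add h'⟩) (fun ⟨_, h⟩ => ⟨_, h.neg⟩)
    (fun ⟨_, h⟩ => ⟨_, h.mul_left _⟩) (fun ⟨_, h⟩ => ⟨_, h.mul_right _⟩)

theorem mem_multiplierIdeal {a : B} : a ∈ multiplierIdeal x ↔ ∃ b, IsMultiplierValue x a b := by
  unfold multiplierIdeal
  rw [TwoSidedIdeal.mem_mk']
  rfl

theorem sq_commutator_eq (w : B) : x * x * w - w * (x * x) =
    x * (x * w - w * x) + (x * w - w * x) * x := by noncomm_ring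

theorem isMultiplierValue_commutator (hB : IsElementwiseSemiprime B)
    (hx : ∀ y z w : B, (x * x * y - y * (x * x)) * z * (x * w - w * x) =
      (x * y - y * x) * z * (x * x * w - w * (x * x))) (y : B) :
    IsMultiplierValue x (x * y - y * x) (x * x * y - y * (x * x)) := by
  refine ⟨hx y, fun t ht z => ?_⟩
  have h1 : ∀ z, (x * y - y * x) * z * t = 0 :=
    hB.mul_mul_comm_eq_zero fun z => ht z y
  rw [sq_commutator_eq, add_mul, add_mul, mul_assoc x, mul_assoc x, h1, mul_zero,
    mul_assoc _ x z, h1, add_zero]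

theorem isMultiplierValue_annihilator {t : B} (ht : ∀ z w : B, t * z * (x * w - w * x) = 0) :
    IsMultiplierValue x t 0 := by
  refine ⟨fun z w => ?_, fun t ht z => by simp⟩
  rw [sq_commutator_eq, mul_add, ← mul_assoc (t * z), mul_assoc t z x, ht, ← mul_assoc (t * z), ht]
  simp

/-- The domain contains the brackets `[x, w]` and their annihilator. If `r` kills the domain from
the left, it lies in that annihilator, so `r` times it is zero and semiprimeness applies. -/
theorem multiplierIdeal_dense (hB : IsElementwiseSemiprime B)
    (hx : ∀ y z w : B, (x * x * y - y * (x * x)) * z * (x * w - w * x) =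
      (x * y - y * x) * z * (x * x * w - w * (x * x))) : IsDense (multiplierIdeal x) := by
  intro _ r hr
  have h0 : ∀ z w : B, r * z * (x * w - w * x) = 0 := by
    intro z w
    rw [mul_assoc]
    exact hr _ (mem_multiplierIdeal.2 ⟨_, (isMultiplierValue_commutator hB hx w).mul_left z⟩)
  refine hB r fun z => ?_
  rw [mul_assoc]
  exact hr _ (mem_multiplierIdeal.2 ⟨_, (isMultiplierValue_annihilator h0).mul_left z⟩)

open Classical in
variable (x) in
/-- The multiplier, extended by zero outside its domain. -/
noncomputable def multiplier (a : B) : B :=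
  if h : ∃ b, IsMultiplierValue x a b then h.choose else 0

theorem multiplier_eq (hB : IsElementwiseSemiprime B) {a b : B} (h : IsMultiplierValue x a b) :
    multiplier x a = b := by
  have h' : ∃ b, IsMultiplierValue x a b := ⟨b, h⟩
  rw [multiplier, dif_pos h']
  exact h'.choose_spec.unique hB h

theorem multiplier_isHomOn (hB : IsElementwiseSemiprime B) :
    IsHomOn (multiplierIdeal x) (multiplier x) := by
  refine ⟨fun a ha b hb => ?_, fun a ha y => ?_⟩
  · obtain ⟨a', ha⟩ := mem_multiplierIdeal.1 ha
    obtain ⟨b', hb⟩ := mem_multiplierIdeal.1 hb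
    rw [multiplier_eq hB ha, multiplier_eq hB hb, multiplier_eq hB (ha.add hb)]
  · obtain ⟨a', ha⟩ := mem_multiplierIdeal.1 ha
    rw [multiplier_eq hB ha, multiplier_eq hB (ha.mul_right y)]

theorem multiplier_mul_left (hB : IsElementwiseSemiprime B) {a : B} (ha : a ∈ multiplierIdeal x)
    (y : B) : multiplier x (y * a) = y * multiplier x a := by
  obtain ⟨a', ha⟩ := mem_multiplierIdeal.1 ha
  rw [multiplier_eq hB ha, multiplier_eq hB (ha.mul_left y)]

end Multiplier

/-- An element satisfying `[x², y] z [x, w] = [x, y] z [x², w]` identically has degree at most two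
over the extended centroid. -/
theorem elementDegree_le_two (hB : IsElementwiseSemiprime B) {x : B}
    (hx : ∀ y z w : B, (x * x * y - y * (x * x)) * z * (x * w - w * x) =
      (x * y - y * x) * z * (x * x * w - w * (x * x))) : elementDegree x ≤ 2 := by
  have hJ := multiplierIdeal_dense hB hx
  have hhom := multiplier_isHomOn (x := x) hB
  have hleft := fun a (ha : a ∈ multiplierIdeal x) y => multiplier_mul_left hB ha y
  let F : DenseMap B := ⟨multiplier x, _, hJ, hhom⟩
  -- `G` represents `μ = x² - λx`, where `λ` is the class of the multiplier. It is left linear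
  -- because `[x², y] = λ[x, y]`.
  let G : DenseMap B := (DenseMap.mulLeft (x * x)).add (F.comp (DenseMap.mulLeft x)).neg
  have hG : ∀ a ∈ multiplierIdeal x, G.toFun a = x * x * a - x * multiplier x a := by
    intro a ha
    change x * x * a + -(multiplier x (x * a)) = _
    rw [hleft a ha, sub_eq_add_neg]
  let lam : ExtendedCentroid B := ⟨Quotient.mk _ F, mk_mem_center_of_left_linear F hJ hhom hleft⟩
  have hGhom : IsHomOn (multiplierIdeal x) G.toFun := by
    refine ⟨fun a ha b hb => ?_, fun a ha y => ?_⟩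
    · rw [hG _ ha, hG _ hb, hG _ (add_mem ha hb), hhom.1 a ha b hb]; noncomm_ring
    · rw [hG _ ha, hG _ (TwoSidedIdeal.mul_mem_right _ _ _ ha), hhom.2 a ha]; noncomm_ring
  have hGleft : ∀ a ∈ multiplierIdeal x, ∀ y : B, G.toFun (y * a) = y * G.toFun a := by
    intro a ha y
    rw [hG _ ha, hG _ (TwoSidedIdeal.mul_mem_left _ _ _ ha), hleft a ha]
    have e1 := multiplier_eq hB ((isMultiplierValue_commutator hB hx y).mul_right a)
    rw [hleft a ha] at e1
    rw [← sub_eq_zero, ← neg_eq_zero, ← sub_eq_zero.2 e1]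
    noncomm_ring
  let mu : ExtendedCentroid B := ⟨Quotient.mk _ G, mk_mem_center_of_left_linear G hJ hGhom hGleft⟩
  let p : Polynomial (ExtendedCentroid B) :=
    Polynomial.X ^ 2 - (Polynomial.C lam * Polynomial.X + Polynomial.C mu)
  have hroot : Polynomial.aeval (RightQuotients.ofBase x) p = 0 := by
    simp only [p, map_sub, map_add, map_mul, map_pow, Polynomial.aeval_X, Polynomial.aeval_C]
    have h1 : RightQuotients.ofBase x ^ 2 = RightQuotients.ofBase (x * x) := by
      rw [map_mul, sq]
    have h2 : (algebraMap (ExtendedCentroid B) (RightQuotients B)) mu =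
      RightQuotients.ofBase (x * x) -
        (algebraMap (ExtendedCentroid B) (RightQuotients B)) lam * RightQuotients.ofBase x := by
      rw [sub_eq_add_neg]; rfl
    rw [h1, h2]; abel
  have hdeg : Polynomial.degree (Polynomial.C lam * Polynomial.X + Polynomial.C mu) <
      ((2 : ℕ) : WithBot ℕ) :=
    lt_of_le_of_lt Polynomial.degree_linear_le (by norm_num)
  refine (iInf_le _ ⟨p, Polynomial.monic_X_pow_sub hdeg, hroot⟩).trans ?_
  have : p.natDegree ≤ 2 := by
    simp only [p]; compute_degree
  exact_mod_cast this

theorem exists_not_identity (hB : IsElementwiseSemiprime B) (hdeg : 2 < degree B) :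
    ∃ x y z w : B, (x * x * y - y * (x * x)) * z * (x * w - w * x) ≠
      (x * y - y * x) * z * (x * x * w - w * (x * x)) := by
  by_contra! h
  exact absurd hdeg (not_lt.2 (iSup_le fun x => elementDegree_le_two hB (h x)))

end Martindale

/-! ### `*`-ideals and `*`-prime quotients -/

theorem span_mul_eq_zero {Φ A : Type*} [CommRing Φ] [NonUnitalRing A] [Module Φ A]
    [IsScalarTower Φ A A] [SMulCommClass Φ A A] {s t : Set A}
    (h : ∀ x ∈ s, ∀ y ∈ t, x * y = 0) {x y : A} (hx : x ∈ Submodule.span Φ s)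
    (hy : y ∈ Submodule.span Φ t) : x * y = 0 := by
  refine Submodule.span_induction (p := fun x _ => x * y = 0) (fun x hx => ?_) (by simp)
    (fun a b _ _ ha hb => by rw [add_mul, ha, hb, add_zero])
    (fun c a _ ha => by rw [smul_mul_assoc, ha, smul_zero]) hx
  exact Submodule.span_induction (p := fun y _ => x * y = 0) (fun y hy => h x hx y hy) (by simp)
    (fun a b _ _ ha hb => by rw [mul_add, ha, hb, add_zero])
    (fun c a _ ha => by rw [mul_smul_comm, ha, smul_zero]) hy

theorem eq_zero_of_two_add {Φ A : Type*} [CommRing Φ] [NonUnitalRing A] [Module Φ A]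
    (h2 : IsUnit (2 : Φ)) {x : A} (hx : x + x = 0) : x = 0 := by
  rw [← two_smul Φ] at hx
  exact (h2.smul_eq_zero).1 hx

theorem eq_zero_of_three_add {Φ A : Type*} [CommRing Φ] [NonUnitalRing A] [Module Φ A]
    (h3 : IsUnit (3 : Φ)) {x : A} (hx : x + x + x = 0) : x = 0 := by
  have : (3 : Φ) • x = 0 := by
    rw [← hx, show (3 : Φ) = 1 + 1 + 1 by norm_num, add_smul, add_smul, one_smul]
  exact (h3.smul_eq_zero).1 this

namespace StarIdeal

variable {Φ A : Type*} [CommRing Φ] [NonUnitalRing A] [StarRing A] [Module Φ A]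

section Quot

variable (I : StarIdeal Φ A)

instance [IsScalarTower Φ A A] : IsScalarTower Φ I.Quot I.Quot where
  smul_assoc c x y := by
    obtain ⟨x, rfl⟩ := I.toQuot_surjective x
    obtain ⟨y, rfl⟩ := I.toQuot_surjective y
    rw [smul_eq_mul, smul_eq_mul, ← map_smul, ← toQuot_mul, ← toQuot_mul, ← map_smul,
      smul_mul_assoc]

instance [SMulCommClass Φ A A] : SMulCommClass Φ I.Quot I.Quot where
  smul_comm c x y := by
    obtain ⟨x, rfl⟩ := I.toQuot_surjective x
    obtain ⟨y, rfl⟩ := I.toQuot_surjective y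
    rw [smul_eq_mul, smul_eq_mul, ← map_smul, ← toQuot_mul, ← toQuot_mul, ← map_smul,
      mul_smul_comm]

instance [Star Φ] [StarModule Φ A] : StarModule Φ I.Quot where
  star_smul c x := by
    obtain ⟨x, rfl⟩ := I.toQuot_surjective x
    rw [← map_smul, ← toQuot_star, ← toQuot_star, ← map_smul, star_smul]

theorem toQuot_eq_zero {x : A} : I.toQuot x = 0 ↔ x ∈ I.toSubmodule :=
  Submodule.Quotient.mk_eq_zero _

end Quot

variable [IsScalarTower Φ A A] [SMulCommClass Φ A A] [Star Φ] [TrivialStar Φ] [StarModule Φ A]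

variable (Φ) in
/-- The `Φ`-span of a multiplicatively absorbing set, stable under the involution. -/
def spanOfAbsorbing (s : Set A) (hl : ∀ a, ∀ x ∈ s, a * x ∈ s) (hr : ∀ a, ∀ x ∈ s, x * a ∈ s)
    (hs : ∀ x ∈ s, star x ∈ s) : StarIdeal Φ A where
  toSubmodule := Submodule.span Φ s
  mul_mem_left' a x hx := by
    change a * x ∈ Submodule.span Φ s
    refine Submodule.span_induction (p := fun x _ => a * x ∈ Submodule.span Φ s)
      (fun x hx => Submodule.subset_span (hl a x hx)) (by simp) (fun x y _ _ hx hy => ?_)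
      (fun c x _ hx => ?_) hx
    · rw [mul_add]; exact add_mem hx hy
    · rw [mul_smul_comm]; exact Submodule.smul_mem _ _ hx
  mul_mem_right' a x hx := by
    change x * a ∈ Submodule.span Φ s
    refine Submodule.span_induction (p := fun x _ => x * a ∈ Submodule.span Φ s)
      (fun x hx => Submodule.subset_span (hr a x hx)) (by simp) (fun x y _ _ hx hy => ?_)
      (fun c x _ hx => ?_) hx
    · rw [add_mul]; exact add_mem hx hy
    · rw [smul_mul_assoc]; exact Submodule.smul_mem _ _ hx
  star_mem' {x} hx := by
    change star x ∈ Submodule.span Φ s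
    refine Submodule.span_induction (p := fun x _ => star x ∈ Submodule.span Φ s)
      (fun x hx => Submodule.subset_span (hs x hx)) (by simp) (fun x y _ _ hx hy => ?_)
      (fun c x _ hx => ?_) hx
    · rw [star_add]; exact add_mem hx hy
    · rw [star_smul, star_trivial c]; exact Submodule.smul_mem _ _ hx

end StarIdeal

/-! ### From `*`-ideals to elementwise conditions -/

section Elementwise

variable {Φ A : Type*} [CommRing Φ] [NonUnitalRing A] [StarRing A] [Module Φ A]

theorem IsStarPrimeAlgebra.isStarSemiprimeAlgebra (h : IsStarPrimeAlgebra Φ A) :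
    IsStarSemiprimeAlgebra Φ A := fun I hI => h I I hI hI

/-- In an elementwise semiprime algebra the intersection of all `*`-prime ideals is zero. -/
theorem IsElementwiseSemiprime.exists_isStarPrime_not_mem (hA : IsElementwiseSemiprime A) {a : A}
    (ha : a ≠ 0) : ∃ I : StarIdeal Φ A, I.IsStarPrime ∧ a ∉ I.toSubmodule := by
  -- Build a sequence of non-zero elements with `a₀ = a` and `aₙ₊₁ = aₙ f(aₙ) aₙ`. A `*`-ideal
  -- maximal among those avoiding all `aₙ` is `*`-prime: once an ideal contains one term it contains
  -- all later ones.
  have hstep : ∀ b : {b : A // b ≠ 0}, ∃ x : A, b.1 * x * b.1 ≠ 0 := by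
    rintro ⟨b, hb⟩
    by_contra! h
    exact hb (hA b h)
  choose f hf using hstep
  let seq : ℕ → {b : A // b ≠ 0} := fun n => Nat.rec ⟨a, ha⟩ (fun _ b => ⟨_, hf b⟩) n
  have hseq : ∀ n, (seq (n + 1)).1 = (seq n).1 * f (seq n) * (seq n).1 := fun n => rfl
  let S : Set (Submodule Φ A) := {N | ((∀ a, ∀ x ∈ N, a * x ∈ N) ∧ (∀ a, ∀ x ∈ N, x * a ∈ N) ∧
    ∀ x ∈ N, star x ∈ N) ∧ ∀ n, (seq n).1 ∉ N}
  have hbot : (⊥ : Submodule Φ A) ∈ S := by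
    refine ⟨⟨?_, ?_, ?_⟩, fun n => ?_⟩
    · intro a x hx; rw [Submodule.mem_bot] at hx ⊢; rw [hx, mul_zero]
    · intro a x hx; rw [Submodule.mem_bot] at hx ⊢; rw [hx, zero_mul]
    · intro x hx; rw [Submodule.mem_bot] at hx ⊢; rw [hx, star_zero]
    · rw [Submodule.mem_bot]; exact (seq n).2
  obtain ⟨N, -, hN⟩ := zorn_le_nonempty₀ S (by
    intro c hcS hc y hy
    have hmem : ∀ {x}, x ∈ sSup c ↔ ∃ N ∈ c, x ∈ N := fun {x} =>
      Submodule.mem_sSup_of_directed ⟨y, hy⟩ hc.directedOn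
    refine ⟨sSup c, ⟨⟨?_, ?_, ?_⟩, ?_⟩, fun z hz => le_sSup hz⟩
    · intro a x hx
      obtain ⟨N, hN, hx⟩ := hmem.1 hx
      exact hmem.2 ⟨N, hN, (hcS hN).1.1 a x hx⟩
    · intro a x hx
      obtain ⟨N, hN, hx⟩ := hmem.1 hx
      exact hmem.2 ⟨N, hN, (hcS hN).1.2.1 a x hx⟩
    · intro x hx
      obtain ⟨N, hN, hx⟩ := hmem.1 hx
      exact hmem.2 ⟨N, hN, (hcS hN).1.2.2 x hx⟩
    · intro n hn
      obtain ⟨N, hN, hx⟩ := hmem.1 hn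
      exact (hcS hN).2 n hx) ⊥ hbot
  let I : StarIdeal Φ A :=
    { N with
      mul_mem_left' := fun a x hx => hN.prop.1.1 a x hx
      mul_mem_right' := fun a x hx => hN.prop.1.2.1 a x hx
      star_mem' := fun hx => hN.prop.1.2.2 _ hx }
  have haI : a ∉ N := hN.prop.2 0
  refine ⟨I, ⟨fun htop => haI ?_, ?_⟩, haI⟩
  · have : a ∈ I.toSubmodule := by rw [htop]; trivial
    exact this
  have hmeet : ∀ J : StarIdeal Φ I.Quot, J.toSubmodule ≠ ⊥ →
      ∃ n, ∀ m, n ≤ m → I.toQuot (seq m).1 ∈ J.toSubmodule := by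
    intro J hJ
    have hlt : N < J.toSubmodule.comap I.toQuot := by
      refine lt_of_le_of_ne (fun x hx => ?_) fun heq => hJ ?_
      · rw [Submodule.mem_comap, I.toQuot_eq_zero.2 hx]; exact zero_mem _
      · rw [eq_bot_iff]
        intro x hx
        obtain ⟨x, rfl⟩ := I.toQuot_surjective x
        have : x ∈ N := by rw [heq]; exact hx
        rw [Submodule.mem_bot]
        exact I.toQuot_eq_zero.2 this
    have hnot : J.toSubmodule.comap I.toQuot ∉ S := fun h => hlt.not_ge (hN.le_of_ge h hlt.le)
    have : ∃ n, I.toQuot (seq n).1 ∈ J.toSubmodule := by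
      by_contra! hcon
      refine hnot ⟨⟨fun a x hx => ?_, fun a x hx => ?_, fun x hx => ?_⟩, hcon⟩
      · exact J.mul_mem_left' (I.toQuot a) hx
      · exact J.mul_mem_right' (I.toQuot a) hx
      · exact J.star_mem' hx
    obtain ⟨n, hn⟩ := this
    refine ⟨n, fun m hm => ?_⟩
    induction m, hm using Nat.le_induction with
    | base => exact hn
    | succ m _ ih =>
      rw [hseq, StarIdeal.toQuot_mul]
      exact J.mul_mem_left' _ ih
  intro J₁ J₂ h₁ h₂
  obtain ⟨n₁, hn₁⟩ := hmeet J₁ h₁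
  obtain ⟨n₂, hn₂⟩ := hmeet J₂ h₂
  -- For large `m` both ideals contain the image of `aₘ`, and the product of `aₘ f(aₘ)` with `aₘ` is
  -- `aₘ₊₁`, which is not in `I`.
  refine ⟨_, J₁.mul_mem_right' (I.toQuot (f (seq (max n₁ n₂)))) (hn₁ _ (le_max_left n₁ n₂)), _,
    hn₂ _ (le_max_right n₁ n₂), ?_⟩
  rw [← StarIdeal.toQuot_mul, ← StarIdeal.toQuot_mul, ← hseq]
  exact fun h => hN.prop.2 (max n₁ n₂ + 1) (I.toQuot_eq_zero.1 h)

variable [IsScalarTower Φ A A] [SMulCommClass Φ A A] [Star Φ] [TrivialStar Φ] [StarModule Φ A]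

theorem IsStarSemiprimeAlgebra.eq_zero_of_absorbing (hA : IsStarSemiprimeAlgebra Φ A) {s : Set A}
    (hl : ∀ a, ∀ x ∈ s, a * x ∈ s) (hr : ∀ a, ∀ x ∈ s, x * a ∈ s)
    (hs : ∀ x ∈ s, star x ∈ s) (h : ∀ x ∈ s, ∀ y ∈ s, x * y = 0) {x : A} (hx : x ∈ s) : x = 0 := by
  by_contra hx0
  obtain ⟨y, hy, z, hz, hyz⟩ := hA (StarIdeal.spanOfAbsorbing Φ s hl hr hs) fun hbot =>
    hx0 (Submodule.span_eq_bot.1 hbot x hx)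
  exact hyz (span_mul_eq_zero h hy hz)

theorem IsStarPrimeAlgebra.eq_zero_of_absorbing (hA : IsStarPrimeAlgebra Φ A) {s t : Set A}
    (hl : ∀ a, ∀ x ∈ s, a * x ∈ s) (hr : ∀ a, ∀ x ∈ s, x * a ∈ s)
    (hs : ∀ x ∈ s, star x ∈ s) (hl' : ∀ a, ∀ x ∈ t, a * x ∈ t) (hr' : ∀ a, ∀ x ∈ t, x * a ∈ t)
    (hs' : ∀ x ∈ t, star x ∈ t) (h : ∀ x ∈ s, ∀ y ∈ t, x * y = 0) :
    (∀ x ∈ s, x = 0) ∨ ∀ x ∈ t, x = 0 := by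
  by_contra! hcon
  obtain ⟨⟨x, hx, hx0⟩, y, hy, hy0⟩ := hcon
  obtain ⟨a, ha, b, hb, hab⟩ := hA (StarIdeal.spanOfAbsorbing Φ s hl hr hs)
    (StarIdeal.spanOfAbsorbing Φ t hl' hr' hs')
    (fun hbot => hx0 (Submodule.span_eq_bot.1 hbot x hx))
    fun hbot => hy0 (Submodule.span_eq_bot.1 hbot y hy)
  exact hab (span_mul_eq_zero h ha hb)

/-- Without a unit, `AuA` need not contain `u`; this lemma allows `AuA` to replace the ideal
generated by `u`. The elements with `AuA = 0` form a `*`-stable absorbing set `U`; products of two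
elements of `UU` vanish, so `UU = 0` and then `U = 0`. -/
theorem IsStarSemiprimeAlgebra.eq_zero_of_mul_mul (hA : IsStarSemiprimeAlgebra Φ A) {u : A}
    (hu : ∀ x y : A, x * u * y = 0) : u = 0 := by
  let U : Set A := {u | ∀ x y : A, x * u * y = 0}
  have hl : ∀ a, ∀ x ∈ U, a * x ∈ U := fun a x hx b c => by rw [← mul_assoc]; exact hx _ _
  have hr : ∀ a, ∀ x ∈ U, x * a ∈ U := fun a x hx b c => by
    rw [← mul_assoc, mul_assoc]; exact hx _ _
  have hs : ∀ x ∈ U, star x ∈ U := fun x hx b c => by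
    have := congrArg star (hx (star c) (star b))
    simpa [mul_assoc] using this
  have hUU : ∀ x ∈ U, ∀ y ∈ U, x * y = 0 := by
    intro x hx y hy
    refine hA.eq_zero_of_absorbing (s := {z | ∃ u ∈ U, ∃ v ∈ U, z = u * v}) ?_ ?_ ?_ ?_
      ⟨x, hx, y, hy, rfl⟩
    · rintro a _ ⟨u, hu, v, hv, rfl⟩
      exact ⟨a * u, hl a u hu, v, hv, (mul_assoc _ _ _).symm⟩
    · rintro a _ ⟨u, hu, v, hv, rfl⟩
      exact ⟨u, hu, v * a, hr a v hv, mul_assoc _ _ _⟩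
    · rintro _ ⟨u, hu, v, hv, rfl⟩
      exact ⟨star v, hs v hv, star u, hs u hu, star_mul _ _⟩
    · rintro _ ⟨u, hu, v, hv, rfl⟩ _ ⟨u', hu', v', hv', rfl⟩
      rw [← mul_assoc, hv u u', zero_mul]
  exact hA.eq_zero_of_absorbing hl hr hs hUU hu

theorem IsStarSemiprimeAlgebra.eq_zero_of_star_mul (hA : IsStarSemiprimeAlgebra Φ A) {b : A}
    (h1 : ∀ x : A, b * x * b = 0) (h2 : ∀ x : A, b * x * star b = 0)
    (h3 : ∀ x : A, star b * x * b = 0) : b = 0 := by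
  have h4 : ∀ x : A, star b * x * star b = 0 := fun x => by
    have := congrArg star (h1 (star x))
    simpa [mul_assoc] using this
  refine hA.eq_zero_of_mul_mul fun x y => ?_
  refine hA.eq_zero_of_absorbing (s := {z | ∃ u, (u = b ∨ u = star b) ∧ ∃ x y, z = x * u * y})
    ?_ ?_ ?_ ?_ ⟨b, .inl rfl, x, y, rfl⟩
  · rintro a _ ⟨u, hu, v, w, rfl⟩
    exact ⟨u, hu, a * v, w, by simp only [mul_assoc]⟩
  · rintro a _ ⟨u, hu, v, w, rfl⟩
    exact ⟨u, hu, v, w * a, by simp only [mul_assoc]⟩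
  · rintro _ ⟨u, hu, v, w, rfl⟩
    refine ⟨star u, ?_, star w, star v, by simp only [star_mul, mul_assoc]⟩
    rcases hu with rfl | rfl <;> simp
  · rintro _ ⟨u, hu, v, w, rfl⟩ _ ⟨u', hu', v', w', rfl⟩
    have : v * u * w * (v' * u' * w') = v * (u * (w * v') * u') * w' := by simp only [mul_assoc]
    rw [this]
    rcases hu with rfl | rfl <;> rcases hu' with rfl | rfl <;> simp [h1, h2, h3, h4]

/-- If `aAa = 0`, elements of `aAa*` and of `a*Aa` satisfy the hypotheses of `eq_zero_of_star_mul`,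
hence vanish; then `a` itself satisfies them. -/
theorem IsStarSemiprimeAlgebra.elementwise (hA : IsStarSemiprimeAlgebra Φ A) :
    IsElementwiseSemiprime A := by
  intro a ha
  have ha' : ∀ x : A, star a * x * star a = 0 := fun x => by
    have := congrArg star (ha (star x))
    simpa [mul_assoc] using this
  have h1 : ∀ x : A, a * x * star a = 0 := by
    intro x
    have key : ∀ x y z : A, a * x * star a * y * (a * z * star a) = 0 := by
      intro x y z
      have : a * x * star a * y * (a * z * star a) = a * (x * star a * y) * a * (z * star a) := by
        simp only [mul_assoc]
      rw [this, ha, zero_mul]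
    have hs : star (a * x * star a) = a * star x * star a := by simp [mul_assoc]
    refine hA.eq_zero_of_star_mul (fun y => key x y x) (fun y => ?_) fun y => ?_
    · rw [hs]; exact key x y _
    · rw [hs]; exact key _ y x
  have h2 : ∀ x : A, star a * x * a = 0 := by
    intro x
    have key : ∀ x y z : A, star a * x * a * y * (star a * z * a) = 0 := by
      intro x y z
      have : star a * x * a * y * (star a * z * a) = star a * x * (a * y * star a) * (z * a) := by
        simp only [mul_assoc]
      rw [this, h1, mul_zero, zero_mul]
    have hs : star (star a * x * a) = star a * star x * a := by simp [mul_assoc]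
    refine hA.eq_zero_of_star_mul (fun y => key x y x) (fun y => ?_) fun y => ?_
    · rw [hs]; exact key x y _
    · rw [hs]; exact key _ y x
  exact hA.eq_zero_of_star_mul ha h1 h2

theorem IsStarPrimeAlgebra.elementwise (hA : IsStarPrimeAlgebra Φ A) (h2 : IsUnit (2 : Φ))
    (h3 : IsUnit (3 : Φ)) : IsElementwiseStarPrime A where
  semiprime := hA.isStarSemiprimeAlgebra.elementwise
  two _ := eq_zero_of_two_add h2
  three _ := eq_zero_of_three_add h3
  prime a b h h' := by
    have hsp := hA.isStarSemiprimeAlgebra.elementwise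
    have hstar : ∀ {c d : A}, (∀ x, c * x * d = 0) → ∀ x, star c * x * star d = 0 := by
      intro c d hcd x
      have := congrArg star (hsp.mul_mul_comm_eq_zero hcd (star x))
      simpa [mul_assoc] using this
    -- Flipping and starring `aAb = 0 = aAb*` also gives `a*Ab* = 0 = a*Ab`, so the `*`-ideals
    -- spanned by the two sets `gen` annihilate each other.
    have k1 := hstar h
    have k2 := hstar h'
    rw [star_star] at k2
    let gen : A → Set A := fun b => {z | ∃ u, (u = b ∨ u = star b) ∧ ∃ x y, z = x * u * y}
    have gl : ∀ b a, ∀ z ∈ gen b, a * z ∈ gen b := by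
      rintro b a _ ⟨u, hu, v, w, rfl⟩
      exact ⟨u, hu, a * v, w, by simp only [mul_assoc]⟩
    have gr : ∀ b a, ∀ z ∈ gen b, z * a ∈ gen b := by
      rintro b a _ ⟨u, hu, v, w, rfl⟩
      exact ⟨u, hu, v, w * a, by simp only [mul_assoc]⟩
    have gs : ∀ b, ∀ z ∈ gen b, star z ∈ gen b := by
      rintro b _ ⟨u, hu, v, w, rfl⟩
      refine ⟨star u, ?_, star w, star v, by simp only [star_mul, mul_assoc]⟩
      rcases hu with rfl | rfl <;> simp
    refine (hA.eq_zero_of_absorbing (gl a) (gr a) (gs a) (gl b) (gr b) (gs b) ?_).imp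
      (fun hz => hA.isStarSemiprimeAlgebra.eq_zero_of_mul_mul fun x y =>
        hz _ ⟨a, .inl rfl, x, y, rfl⟩)
      (fun hz => hA.isStarSemiprimeAlgebra.eq_zero_of_mul_mul fun x y =>
        hz _ ⟨b, .inl rfl, x, y, rfl⟩)
    rintro _ ⟨u, hu, v, w, rfl⟩ _ ⟨u', hu', v', w', rfl⟩
    have : v * u * w * (v' * u' * w') = v * (u * (w * v') * u') * w' := by simp only [mul_assoc]
    rw [this]
    rcases hu with rfl | rfl <;> rcases hu' with rfl | rfl <;> simp [h, h', k1, k2]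

end Elementwise

/-! ### Derivations commuting with the involution -/

section Main

variable {Φ A : Type*} [CommRing Φ] [Star Φ] [TrivialStar Φ] [NonUnitalRing A] [Module Φ A]
  [IsScalarTower Φ A A] [SMulCommClass Φ A A] [StarRing A] [StarModule Φ A]

/-- In a `*`-prime quotient of degree greater than two, some square of a skew element does not
commute with all skew elements. -/
theorem StarIdeal.IsStarPrime.exists_skew_not_mem (h2 : IsUnit (2 : Φ)) (h3 : IsUnit (3 : Φ))
    {I : StarIdeal Φ A} (hI : I.IsStarPrime) (hdeg : 2 < Martindale.degree I.Quot) :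
    ∃ u v : A, star u = -u ∧ star v = -v ∧ u * u * v - v * (u * u) ∉ I.toSubmodule := by
  have hB := hI.2.elementwise h2 h3
  by_contra! hcon
  obtain ⟨x, y, z, w, hne⟩ := Martindale.exists_not_identity hB.semiprime hdeg
  refine hne (hB.degree_identity (fun u v hu hv => ?_) x y z w)
  obtain ⟨u, rfl⟩ := I.toQuot_surjective u
  obtain ⟨v, rfl⟩ := I.toQuot_surjective v
  have h := I.toQuot_eq_zero.2 (hcon (u - star u) (v - star v) (by simp) (by simp))
  simp only [map_sub, StarIdeal.toQuot_mul, StarIdeal.toQuot_star, hu, hv] at h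
  -- A skew class need not come with a skew representative; `u - u*` is skew and maps to `2u`, so
  -- the cubic expression picks up a factor 8.
  refine sub_eq_zero.1 (hB.two _ (hB.two _ (hB.two _ ?_)))
  rw [← h]
  noncomm_ring

/-- A skew element `c` with `[c, [c, K]]` central is central. -/
theorem central_of_lie_lie_skew_central (h2 : IsUnit (2 : Φ)) (h3 : IsUnit (3 : Φ))
    (hA : IsStarSemiprimeAlgebra Φ A)
    (hdeg : ∀ I : StarIdeal Φ A, I.IsStarPrime → 2 < Martindale.degree I.Quot)
    {c : A} (hc : star c = -c)
    (h : ∀ k : A, star k = -k → ∀ x, (c * (c * k - k * c) - (c * k - k * c) * c) * x =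
      x * (c * (c * k - k * c) - (c * k - k * c) * c)) (r : A) : c * r = r * c := by
  by_contra hne
  obtain ⟨I, hI, hmem⟩ :=
    hA.elementwise.exists_isStarPrime_not_mem (Φ := Φ) (sub_ne_zero.2 hne)
  obtain ⟨u, v, hu, hv, huv⟩ := hI.exists_skew_not_mem h2 h3 (hdeg I hI)
  have hB := hI.2.elementwise h2 h3
  refine hmem (I.toQuot_eq_zero.1 ?_)
  rw [map_sub, StarIdeal.toQuot_mul, StarIdeal.toQuot_mul, sub_eq_zero]
  refine hB.central_of_lie_lie_central (u := I.toQuot u) (v := I.toQuot v)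
    (by rw [← StarIdeal.toQuot_star, hc, map_neg]) ?_
    (by rw [← StarIdeal.toQuot_star, hu, map_neg]) (by rw [← StarIdeal.toQuot_star, hv, map_neg])
    (fun h0 => huv (I.toQuot_eq_zero.1 ?_)) _
  · intro k hk x
    obtain ⟨k, rfl⟩ := I.toQuot_surjective k
    obtain ⟨x, rfl⟩ := I.toQuot_surjective x
    have e := congrArg I.toQuot (h (k - star k) (by simp) x)
    simp only [map_sub, StarIdeal.toQuot_mul, StarIdeal.toQuot_star, hk] at e
    refine sub_eq_zero.1 (hB.two _ ?_)
    rw [← sub_eq_zero.2 e]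
    noncomm_ring
  · simpa only [map_sub, StarIdeal.toQuot_mul] using h0

theorem IsElementwiseStarPrime.skew_central_regular (hA : IsElementwiseStarPrime A) {s y : A}
    (hs : ∀ x, s * x = x * s) (hss : star s = -s) (h : s * y = 0) : s = 0 ∨ y = 0 := by
  refine (hA.prime y s (fun x => ?_) fun x => ?_).symm
  · rw [← hs, ← mul_assoc, h, zero_mul]
  · rw [hss, mul_neg, ← hs, ← mul_assoc, h, zero_mul, neg_zero]

/-- A derivation in `SDer(A)` that maps the skew elements into the center vanishes. -/
theorem SDer.eq_zero_of_skew_central (h2 : IsUnit (2 : Φ)) (h3 : IsUnit (3 : Φ))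
    (hA : IsStarSemiprimeAlgebra Φ A)
    (hdeg : ∀ I : StarIdeal Φ A, I.IsStarPrime → 2 < Martindale.degree I.Quot)
    (δ : SDer Φ A) (hδ : ∀ k : A, star k = -k → ∀ x, δ.1.1 k * x = x * δ.1.1 k) : δ = 0 := by
  have hmul : ∀ x y, δ.1.1 (x * y) = δ.1.1 x * y + x * δ.1.1 y := δ.1.2
  have hstar : ∀ x, δ.1.1 (star x) = star (δ.1.1 x) := δ.2
  have hsk : ∀ k : A, star k = -k → star (δ.1.1 k) = -δ.1.1 k := by
    intro k hk; rw [← hstar, hk, map_neg]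
  -- `k³` is skew, so `δ(k³) = 3 δ(k) k²` is central along with `δ(k)`.
  have hcube : ∀ k : A, star k = -k → ∀ y, δ.1.1 k * (k * k * y - y * (k * k)) = 0 := by
    intro k hk y
    apply eq_zero_of_three_add h3
    have e := hδ _ (star_mul_mul_of_skew hk hk) y
    have hz := hδ k hk
    have e1 : δ.1.1 (k * k * k) = δ.1.1 k * (k * k) + δ.1.1 k * (k * k) + δ.1.1 k * (k * k) := by
      rw [hmul, hmul, ← hz k, ← hz (k * k)]
      noncomm_ring
    rw [e1] at e
    rw [← sub_eq_zero.2 e]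
    have e2 : y * (δ.1.1 k * (k * k)) = δ.1.1 k * (y * (k * k)) := by
      rw [← mul_assoc, ← hz, mul_assoc]
    simp only [mul_add, add_mul, mul_sub, e2, mul_assoc]
    abel
  have hzero : ∀ k : A, star k = -k → δ.1.1 k = 0 := by
    intro k₀ hk₀
    by_contra hne
    obtain ⟨I, hI, hmem⟩ := hA.elementwise.exists_isStarPrime_not_mem (Φ := Φ) hne
    obtain ⟨u, v, hu, hv, huv⟩ := hI.exists_skew_not_mem h2 h3 (hdeg I hI)
    have hB := hI.2.elementwise h2 h3
    -- Modulo `I` the skew central element `δ(k)` is regular if non-zero, so `k²` is then central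
    -- modulo `I`.
    have hreg : ∀ k : A, star k = -k → δ.1.1 k ∉ I.toSubmodule →
        ∀ y, k * k * y - y * (k * k) ∈ I.toSubmodule := by
      intro k hk hnot y
      have hcen : ∀ x, I.toQuot (δ.1.1 k) * x = x * I.toQuot (δ.1.1 k) := by
        intro x
        obtain ⟨x, rfl⟩ := I.toQuot_surjective x
        rw [← StarIdeal.toQuot_mul, hδ k hk, StarIdeal.toQuot_mul]
      refine I.toQuot_eq_zero.1 ((hB.skew_central_regular hcen ?_ ?_).resolve_left
        fun h0 => hnot (I.toQuot_eq_zero.1 h0))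
      · rw [← StarIdeal.toQuot_star, hsk k hk, map_neg]
      · rw [← StarIdeal.toQuot_mul, hcube k hk, map_zero]
    refine huv ?_
    by_cases hu0 : δ.1.1 u ∈ I.toSubmodule
    swap
    · exact hreg u hu hu0 v
    -- When `δ(u) ∈ I`, the derivation does not send `u ± k₀` into `I`, and `2u² = (u + k₀)² + (u -
    -- k₀)² - 2k₀²`.
    have e1 := hreg (u + k₀) (by rw [star_add, hu, hk₀]; abel)
      (fun h => hmem (by rw [map_add] at h; exact (Submodule.add_mem_iff_right _ hu0).1 h)) v
    have e2 := hreg (u - k₀) (by rw [star_sub, hu, hk₀]; abel)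
      (fun h => hmem (by
        rw [map_sub] at h; have := sub_mem hu0 h; rwa [sub_sub_cancel] at this)) v
    have e3 := hreg k₀ hk₀ hmem v
    have e4 := sub_mem (sub_mem (add_mem e1 e2) e3) e3
    refine I.toQuot_eq_zero.1 (hB.two _ ?_)
    rw [← map_add, ← I.toQuot_eq_zero.2 e4]
    congr 1
    noncomm_ring
  have hann : ∀ u v : A, star u = -u → star v = -v → ∀ x r,
      (u * u * v - v * (u * u)) * x * δ.1.1 r = 0 := by
    intro u v hu hv x r
    have key := commutator_mul_derivation_eq_zero (fun _ => eq_zero_of_two_add h2)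
      δ.1.1.toAddMonoidHom hmul hzero hu hv
    have e := key (x * r)
    change _ * δ.1.1 (x * r) = 0 at e
    have e' : _ * δ.1.1 x = 0 := key x
    rw [hmul, mul_add, ← mul_assoc, e', zero_mul, zero_add, ← mul_assoc] at e
    exact e
  apply Subtype.ext
  apply Subtype.ext
  ext r
  change δ.1.1 r = 0
  by_contra hne
  obtain ⟨I, hI, hmem⟩ := hA.elementwise.exists_isStarPrime_not_mem (Φ := Φ) hne
  obtain ⟨u, v, hu, hv, huv⟩ := hI.exists_skew_not_mem h2 h3 (hdeg I hI)
  have hB := hI.2.elementwise h2 h3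
  refine hmem (I.toQuot_eq_zero.1 ((hB.prime (I.toQuot (u * u * v - v * (u * u)))
    (I.toQuot (δ.1.1 r)) (fun x => ?_) (fun x => ?_)).resolve_left
      fun h0 => huv (I.toQuot_eq_zero.1 h0)))
  · obtain ⟨x, rfl⟩ := I.toQuot_surjective x
    rw [← StarIdeal.toQuot_mul, ← StarIdeal.toQuot_mul, hann u v hu hv, map_zero]
  · obtain ⟨x, rfl⟩ := I.toQuot_surjective x
    rw [← StarIdeal.toQuot_star, ← hstar, ← StarIdeal.toQuot_mul, ← StarIdeal.toQuot_mul,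
      hann u v hu hv, map_zero]

/-! ### Inner derivations of skew elements and strong non-degeneracy -/

variable (Φ) in
/-- The inner derivation of a skew element. -/
def SDer.inner : skewAdjoint A →+ SDer Φ A where
  toFun k := ⟨⟨LinearMap.mulLeft Φ k.1 - LinearMap.mulRight Φ k.1, fun x y => by
      change k.1 * (x * y) - x * y * k.1 = (k.1 * x - x * k.1) * y + x * (k.1 * y - y * k.1)
      noncomm_ring⟩, fun x => by
      change k.1 * star x - star x * k.1 = star (k.1 * x - x * k.1)
      rw [star_sub, star_mul, star_mul, skewAdjoint.mem_iff.1 k.2]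
      noncomm_ring⟩
  map_zero' := by
    apply Subtype.ext; apply Subtype.ext; ext x
    change (0 : A) * x - x * 0 = 0
    simp
  map_add' k l := by
    apply Subtype.ext; apply Subtype.ext; ext x
    change (k.1 + l.1) * x - x * (k.1 + l.1) = (k.1 * x - x * k.1) + (l.1 * x - x * l.1)
    noncomm_ring

/-- The action of `SDer(A)` on skew elements. -/
def SDer.onSkew (δ : SDer Φ A) (k : skewAdjoint A) : skewAdjoint A :=
  ⟨δ.1.1 k.1, by
    have hk := k.2
    rw [skewAdjoint.mem_iff] at hk ⊢
    rw [← δ.2 k.1, hk, map_neg]⟩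

theorem SDer.lie_inner (δ : SDer Φ A) (k : skewAdjoint A) :
    ⁅δ, SDer.inner Φ k⁆ = SDer.inner Φ (SDer.onSkew δ k) := by
  apply Subtype.ext; apply Subtype.ext; ext x
  change δ.1.1 (k.1 * x - x * k.1) - (k.1 * δ.1.1 x - δ.1.1 x * k.1) =
    δ.1.1 k.1 * x - x * δ.1.1 k.1
  have hmul : ∀ x y, δ.1.1 (x * y) = δ.1.1 x * y + x * δ.1.1 y := δ.1.2
  rw [map_sub, hmul, hmul]
  abel

theorem SDer.quotient_stronglyNondegenerate (h2 : IsUnit (2 : Φ)) (h3 : IsUnit (3 : Φ))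
    (hA : IsStarSemiprimeAlgebra Φ A)
    (hdeg : ∀ I : StarIdeal Φ A, I.IsStarPrime → 2 < Martindale.degree I.Quot) :
    StronglyNondegenerate (SDer Φ A ⧸ skewToCenterIdeal Φ A) := by
  intro x hx
  obtain ⟨δ, rfl⟩ := LieSubmodule.Quotient.surjective_mk' (skewToCenterIdeal Φ A) x
  have t2 : ∀ y : SDer Φ A ⧸ skewToCenterIdeal Φ A, y + y = 0 → y = 0 :=
    fun y hy => by rw [← two_smul Φ] at hy; exact (h2.smul_eq_zero).1 hy
  have t3 : ∀ y : SDer Φ A ⧸ skewToCenterIdeal Φ A, y + y + y = 0 → y = 0 := by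
    intro y hy
    have : (3 : Φ) • y = 0 := by
      rw [← hy, show (3 : Φ) = 1 + 1 + 1 by norm_num, add_smul, add_smul, one_smul]
    exact (h3.smul_eq_zero).1 this
  let π : SDer Φ A → SDer Φ A ⧸ skewToCenterIdeal Φ A := LieSubmodule.Quotient.mk
  have hπ : ∀ a b, ⁅π a, π b⁆ = π ⁅a, b⁆ := fun a b => rfl
  have hN := fun {c : A} => central_of_lie_lie_skew_central h2 h3 hA hdeg (c := c)
  have hin : ∀ k l : skewAdjoint A, ⁅π (inner Φ k), π (inner Φ l)⁆ =
      π (inner Φ (onSkew (inner Φ k) l)) := fun k l => by rw [hπ, lie_inner]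
  -- If `[e, K]` is central then `[e, [e, K]] = 0`, so the associative theorem applies to `e`.
  have hzero : ∀ e : skewAdjoint A, π (inner Φ e) = 0 → ∀ r, e.1 * r = r * e.1 := by
    intro e he
    have he : inner Φ e ∈ skewToCenterIdeal Φ A :=
      (LieSubmodule.Quotient.mk_eq_zero (N := skewToCenterIdeal Φ A)).1 he
    have he : ∀ k ∈ skewAdjoint A, e.1 * k - k * e.1 ∈ NonUnitalSubring.center A := he
    refine hN (skewAdjoint.mem_iff.1 e.2) fun k hk x => ?_
    have := NonUnitalSubring.mem_center_iff.1 (he k (skewAdjoint.mem_iff.2 hk)) e.1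
    rw [this, sub_self, zero_mul, mul_zero]
  have hcen : ∀ e : skewAdjoint A,
      (∀ k, π (inner Φ (onSkew (inner Φ e) (onSkew (inner Φ e) k))) = 0) →
      ∀ r, e.1 * r = r * e.1 := fun e he =>
    hN (skewAdjoint.mem_iff.1 e.2) fun k hk => hzero _ (he ⟨k, skewAdjoint.mem_iff.2 hk⟩)
  let S : AddSubgroup (SDer Φ A ⧸ skewToCenterIdeal Φ A) :=
    { carrier := {y | ∃ k : skewAdjoint A, y = π (inner Φ k)}
      zero_mem' := ⟨0, by rw [map_zero]; rfl⟩
      add_mem' := by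
        rintro _ _ ⟨k, rfl⟩ ⟨l, rfl⟩
        exact ⟨k + l, by rw [map_add]; rfl⟩
      neg_mem' := by
        rintro _ ⟨k, rfl⟩
        exact ⟨-k, by rw [map_neg]; rfl⟩ }
  have hx' : ∀ y : SDer Φ A ⧸ skewToCenterIdeal Φ A, ⁅π δ, ⁅π δ, y⁆⁆ = 0 := hx
  have hδin : ∀ k, ⁅π δ, π (inner Φ k)⁆ = π (inner Φ (onSkew δ k)) := fun k => by
    rw [hπ, lie_inner]
  have hS : ∀ a ∈ S, ⁅⁅π δ, a⁆, ⁅⁅π δ, a⁆, a⁆⁆ = 0 := by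
    rintro _ ⟨k, rfl⟩
    -- The cubic value is the class of `ad τ`, `τ = [δk, [δk, k]]`, and is an absolute zero divisor.
    -- Testing this on inner derivations only is enough for `hcen` to make `τ` central.
    have habs := fun l => absolute_zero_lie_lie t2 hx' (π (inner Φ k)) (π (inner Φ l))
    simp only [hδin, hin] at habs ⊢
    have hτ := hcen _ habs
    have : inner Φ (onSkew (inner Φ (onSkew δ k)) (onSkew (inner Φ (onSkew δ k)) k)) = 0 := by
      apply Subtype.ext; apply Subtype.ext; ext r
      exact sub_eq_zero.2 (hτ r)
    rw [this]; rfl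
  refine (LieSubmodule.Quotient.mk_eq_zero (N := skewToCenterIdeal Φ A)).2 ?_
  change ∀ k ∈ skewAdjoint A, δ.1.1 k ∈ NonUnitalSubring.center A
  intro k hk
  rw [NonUnitalSubring.mem_center_iff]
  intro r
  refine (hcen (onSkew δ ⟨k, hk⟩) (fun l => ?_) r).symm
  have := lie_lie_eq_zero_of_cubic t2 t3 hx' hS ⟨⟨k, hk⟩, rfl⟩ ⟨l, rfl⟩
  simpa only [hδin, hin] using this

theorem SDer.stronglyNondegenerate (h2 : IsUnit (2 : Φ)) (h3 : IsUnit (3 : Φ))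
    (hA : IsStarSemiprimeAlgebra Φ A)
    (hdeg : ∀ I : StarIdeal Φ A, I.IsStarPrime → 2 < Martindale.degree I.Quot) :
    StronglyNondegenerate (SDer Φ A) := by
  intro δ hδ
  -- An absolute zero divisor stays one in the quotient, so `δ` lies in `I_{K,Z}`, which is zero.
  have h0 := SDer.quotient_stronglyNondegenerate h2 h3 hA hdeg
    (LieSubmodule.Quotient.mk δ : SDer Φ A ⧸ skewToCenterIdeal Φ A) (by
      intro y
      obtain ⟨μ, rfl⟩ := LieSubmodule.Quotient.surjective_mk' (skewToCenterIdeal Φ A) y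
      exact congrArg (LieSubmodule.Quotient.mk (N := skewToCenterIdeal Φ A)) (hδ μ))
  have hmem : ∀ k ∈ skewAdjoint A, δ.1.1 k ∈ NonUnitalSubring.center A :=
    (LieSubmodule.Quotient.mk_eq_zero (N := skewToCenterIdeal Φ A)).1 h0
  exact SDer.eq_zero_of_skew_central h2 h3 hA hdeg δ fun k hk x =>
    (NonUnitalSubring.mem_center_iff.1 (hmem k (skewAdjoint.mem_iff.2 hk)) x).symm

end Main

/-- The center of the Lie algebra of skew elements contains no non-zero `*`-ideal. -/
theorem StarIdeal.eq_bot_of_subset_skewCenter {Φ A : Type*} [CommRing Φ] [NonUnitalRing A]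
    [StarRing A] [Module Φ A] (h2 : IsUnit (2 : Φ))
    (hA : IsStarSemiprimeAlgebra Φ A) (I : StarIdeal Φ A)
    (hI : ∀ x ∈ I.toSubmodule, x ∈ skewCenter A) : I.toSubmodule = ⊥ := by
  by_contra hne
  obtain ⟨x, hx, y, hy, hxy⟩ := hA I hne
  refine hxy (eq_zero_of_two_add h2 ?_)
  -- `xy` lies in `I`, hence is skew, while `(xy)* = yx = xy`; so `2xy = 0`.
  have e1 := skewAdjoint.mem_iff.1 (hI _ (I.mul_mem_right' y hx)).1
  have e2 := (hI x hx).2 y (hI y hy).1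
  rw [star_mul, skewAdjoint.mem_iff.1 (hI x hx).1, skewAdjoint.mem_iff.1 (hI y hy).1,
    neg_mul_neg, ← sub_eq_zero.1 e2] at e1
  exact eq_neg_iff_add_eq_zero.1 e1

theorem mainTheorem3 {Φ A : Type*} [CommRing Φ] [Star Φ] [TrivialStar Φ]
    [NonUnitalRing A] [Module Φ A] [IsScalarTower Φ A A] [SMulCommClass Φ A A]
    [StarRing A] [StarModule Φ A]
    (h2 : IsUnit (2 : Φ)) (h3 : IsUnit (3 : Φ))
    (hsemiprime : IsStarSemiprimeAlgebra Φ A)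
    (hnoncomm : ∃ a b : A, a * b ≠ b * a)
    (hdeg : ∀ I : StarIdeal Φ A, I.IsStarPrime → 2 < Martindale.degree I.Quot) :
    StronglyNondegenerate (SDer Φ A ⧸ skewToCenterIdeal Φ A) ∧
    ((∀ I : StarIdeal Φ A, (∀ x ∈ I.toSubmodule, x ∈ skewCenter A) → I.toSubmodule = ⊥) →
      StronglyNondegenerate (SDer Φ A)) ∧
    (IsStarPrimeAlgebra Φ A →
      (∀ I : StarIdeal Φ A, (∀ x ∈ I.toSubmodule, x ∈ skewCenter A) → I.toSubmodule = ⊥) ∧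
      StronglyNondegenerate (SDer Φ A)) :=
  ⟨SDer.quotient_stronglyNondegenerate h2 h3 hsemiprime hdeg,
    fun _ => SDer.stronglyNondegenerate h2 h3 hsemiprime hdeg,
    fun _ => ⟨StarIdeal.eq_bot_of_subset_skewCenter h2 hsemiprime,
      SDer.stronglyNondegenerate h2 h3 hsemiprime hdeg⟩⟩
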